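/- Let $\mathrm{GL}^+(2)=\{F\in\mathbb R^{2\times2}:\det F>0\}$ and let $W:\mathrm{GL}^+(2)\to\mathbb R$ be a twice differentiable isotropic energy with a volumetric-isochoric split $$W(F)=h\!\left(\frac{\lambda_1}{\lambda_2}\right)+f(\lambda_1\lambda_2),\qquad h,f:(0,\infty)\to\mathbb R,\quad h(t)=h(1/t)\ \text{ for all } t>0,$$ where $\lambda_1,\lambda_2>0$ are the singular values of $F$. Suppose that $W$ is rank-one convex but not quasiconvex. Then $f$ is twice differentiable on $(0,\infty)$, $\inf_{z>0}z^2f''(z)$ is finite, and for $$c:=-\inf_{z\in(0,\infty)}z^2f''(z)\in\mathbb R$$ the energy $$W_0(F)=h\!\left(\frac{\lambda_1}{\lambda_2}\right)+c\,\log(\lambda_1\lambda_2)$$ is also rank-one convex but not quasiconvex. Moreover $c\neq0$, and the energy $$\frac1{|c|}\,h\!\left(\frac{\lambda_1}{\lambda_2}\right)+\log(\lambda_1\lambda_2)\ \text{ (if } c>0),\qquad \frac1{|c|}\,h\!\left(\frac{\lambda_1}{\lambda_2}\right)-\log(\lambda_1\lambda_2)\ \text{ (if } c<0)$$ is rank-one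 convex but not quasiconvex; that is, up to a positive multiple of the energy, the volumetric part can be replaced by $\pm\log\det F$. Here a function on $\mathrm{GL}^+(2)$ is called rank-one convex (quasiconvex) if its extension $\widehat W:\mathbb R^{2\times2}\to\mathbb R\cup\{+\infty\}$ by $+\infty$ is. $\widehat W$ is rank-one convex if $\widehat W(tF_1+(1-t)F_2)\le t\widehat W(F_1)+(1-t)\widehat W(F_2)$ whenever $\operatorname{rank}(F_1-F_2)=1$ and $t\in(0,1)$. $\widehat W$ is quasiconvex if $\int_\Omega\widehat W(F_0+\nabla\vartheta(x))\,dx\ge|\Omega|\,\widehat W(F_0)$ for every domain $\Omega\subset\mathbb R^2$ of finite Lebesgue measure $|\Omega|$, every $F_0\in\mathbb R^{2\times2}$ and every $\vartheta\in W_0^{1,\infty}(\Omega;\mathbb R^2)=W^{1,\infty}(\Omega;\mathbb R^2)\cap W^{1,1}_0(\Omega;\mathbb R^2)$ for which the integral exists in $[-\infty,+\infty]$. -/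

import Mathlib

open MeasureTheory Filter Topology
open scoped ContDiff ENNReal

/- All norms on a space of real `n × n` matrices are equivalent; the entrywise one is used to speak
about differentiability of functions of a matrix. -/
attribute [local instance] Matrix.normedAddCommGroup Matrix.normedSpace

noncomputable section

namespace VolIso

/-! ### Rank-one convexity -/

/-- Rank-one convexity of a function `W : ℝ^{n×n} → ℝ ∪ {+∞}`. -/
def IsRankOneConvex {n : ℕ} (W : Matrix (Fin n) (Fin n) ℝ → EReal) : Prop :=
  ∀ F₁ F₂ : Matrix (Fin n) (Fin n) ℝ, (F₁ - F₂).rank = 1 → ∀ t : ℝ, 0 < t → t < 1 →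
    W (t • F₁ + (1 - t) • F₂) ≤ (t : EReal) * W F₁ + ((1 - t : ℝ) : EReal) * W F₂

/-! ### The Sobolev space `W₀^{1,∞}(Ω; ℝⁿ)` -/

/-- The partial derivative `∂ⱼ φ` of a real function on `ℝⁿ`. -/
def partialDeriv {n : ℕ} (j : Fin n) (φ : EuclideanSpace ℝ (Fin n) → ℝ)
    (x : EuclideanSpace ℝ (Fin n)) : ℝ :=
  fderiv ℝ φ x (EuclideanSpace.single j 1)

/-- `φ ∈ C_c^∞(Ω; E)`. -/
def IsTestFunction {n : ℕ} {E : Type*} [NormedAddCommGroup E] [NormedSpace ℝ E]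
    (Ω : Set (EuclideanSpace ℝ (Fin n))) (φ : EuclideanSpace ℝ (Fin n) → E) : Prop :=
  ContDiff ℝ ∞ φ ∧ HasCompactSupport φ ∧ tsupport φ ⊆ Ω

/-- `G` is the weak gradient on `Ω` of the vector field `u`, that is `G i j = ∂ⱼ uᵢ` in the sense of
distributions. -/
def IsWeakGradient {n : ℕ} (Ω : Set (EuclideanSpace ℝ (Fin n)))
    (u : EuclideanSpace ℝ (Fin n) → EuclideanSpace ℝ (Fin n))
    (G : EuclideanSpace ℝ (Fin n) → Matrix (Fin n) (Fin n) ℝ) : Prop :=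
  ∀ φ : EuclideanSpace ℝ (Fin n) → ℝ, IsTestFunction Ω φ → ∀ i j : Fin n,
    ∫ x in Ω, u x i * partialDeriv j φ x = - ∫ x in Ω, G x i j * φ x

/-- `u` belongs to `W^{1,p}(Ω; ℝⁿ)` and has the weak gradient `G`. -/
structure MemSobolev {n : ℕ} (p : ℝ≥0∞) (Ω : Set (EuclideanSpace ℝ (Fin n)))
    (u : EuclideanSpace ℝ (Fin n) → EuclideanSpace ℝ (Fin n))
    (G : EuclideanSpace ℝ (Fin n) → Matrix (Fin n) (Fin n) ℝ) : Prop where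
  memLp : MemLp u p (volume.restrict Ω)
  memLp_grad : ∀ i j : Fin n, MemLp (fun x => G x i j) p (volume.restrict Ω)
  weakGradient : IsWeakGradient Ω u G

/-- `u`, with weak gradient `G`, belongs to the closure of `C_c^∞(Ω; ℝⁿ)` with respect to the norm
of `W^{1,p}(Ω; ℝⁿ)`. -/
def IsLimitOfTestFunctions {n : ℕ} (p : ℝ≥0∞) (Ω : Set (EuclideanSpace ℝ (Fin n)))
    (u : EuclideanSpace ℝ (Fin n) → EuclideanSpace ℝ (Fin n))
    (G : EuclideanSpace ℝ (Fin n) → Matrix (Fin n) (Fin n) ℝ) : Prop :=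
  ∃ φ : ℕ → EuclideanSpace ℝ (Fin n) → EuclideanSpace ℝ (Fin n),
    (∀ k, IsTestFunction Ω (φ k)) ∧
    Tendsto (fun k => eLpNorm (fun x => φ k x - u x) p (volume.restrict Ω)) atTop (𝓝 0) ∧
    ∀ i j : Fin n, Tendsto
      (fun k => eLpNorm (fun x => partialDeriv j (fun y => φ k y i) x - G x i j) p
        (volume.restrict Ω)) atTop (𝓝 0)

/-- `u` belongs to `W₀^{1,∞}(Ω; ℝⁿ)` and has the weak gradient `G`. As usual in the calculus of
variations, `W₀^{1,∞} = W^{1,∞} ∩ W₀^{1,1}` (the closure of `C_c^∞` in the norm of `W^{1,∞}` would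
contain `C¹` functions only). -/
def MemSobolevZeroInfty {n : ℕ} (Ω : Set (EuclideanSpace ℝ (Fin n)))
    (u : EuclideanSpace ℝ (Fin n) → EuclideanSpace ℝ (Fin n))
    (G : EuclideanSpace ℝ (Fin n) → Matrix (Fin n) (Fin n) ℝ) : Prop :=
  MemSobolev ⊤ Ω u G ∧ IsLimitOfTestFunctions 1 Ω u G

/-! ### Quasiconvexity -/

/-- The integral over `Ω` of an extended real function exists in `[-∞, +∞]`: the function is
measurable and its positive part or its negative part has a finite integral. -/
def IntegralExists {n : ℕ} (Ω : Set (EuclideanSpace ℝ (Fin n)))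
    (g : EuclideanSpace ℝ (Fin n) → EReal) : Prop :=
  AEMeasurable g (volume.restrict Ω) ∧
    (∫⁻ x in Ω, (g x).toENNReal ≠ ⊤ ∨ ∫⁻ x in Ω, (-g x).toENNReal ≠ ⊤)

/-- The integral over `Ω` of an extended real function, as the integral of the positive part minus
the integral of the negative part; meaningful when `IntegralExists Ω g` holds. -/
def extIntegral {n : ℕ} (Ω : Set (EuclideanSpace ℝ (Fin n)))
    (g : EuclideanSpace ℝ (Fin n) → EReal) : EReal :=
  ((∫⁻ x in Ω, (g x).toENNReal : ℝ≥0∞) : EReal) - ((∫⁻ x in Ω, (-g x).toENNReal : ℝ≥0∞) : EReal)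

/-- Quasiconvexity of a function `W : ℝ^{n×n} → ℝ ∪ {+∞}`: for all domains `Ω` of finite measure,
`F₀` and `ϑ ∈ W₀^{1,∞}(Ω; ℝⁿ)` with gradient `G`, one has `∫_Ω W(F₀ + ∇ϑ) ≥ |Ω| W(F₀)`
whenever the integral exists. -/
def IsQuasiconvex {n : ℕ} (W : Matrix (Fin n) (Fin n) ℝ → EReal) : Prop :=
  ∀ Ω : Set (EuclideanSpace ℝ (Fin n)), IsOpen Ω → IsConnected Ω → volume Ω ≠ ⊤ →
    ∀ (F₀ : Matrix (Fin n) (Fin n) ℝ)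
      (θ : EuclideanSpace ℝ (Fin n) → EuclideanSpace ℝ (Fin n))
      (G : EuclideanSpace ℝ (Fin n) → Matrix (Fin n) (Fin n) ℝ),
      MemSobolevZeroInfty Ω θ G → IntegralExists Ω (fun x => W (F₀ + G x)) →
        ((volume Ω : ℝ≥0∞) : EReal) * W F₀ ≤ extIntegral Ω (fun x => W (F₀ + G x))

/-! ### Energies on `GL⁺(n)` -/

/-- The extension by `+∞` of a function on `GL⁺(n) = {F | det F > 0}` to all matrices. A function on
`GL⁺(n)` is written as a function of all matrices; its values off `GL⁺(n)` are not used. -/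
def extendGLPos {n : ℕ} (W : Matrix (Fin n) (Fin n) ℝ → ℝ) (F : Matrix (Fin n) (Fin n) ℝ) : EReal :=
  if 0 < F.det then (W F : EReal) else ⊤

/-- A function on `GL⁺(n)` is rank-one convex if its extension by `+∞` is. -/
def IsRankOneConvexGLPos {n : ℕ} (W : Matrix (Fin n) (Fin n) ℝ → ℝ) : Prop :=
  IsRankOneConvex (extendGLPos W)

/-- A function on `GL⁺(n)` is quasiconvex if its extension by `+∞` is. -/
def IsQuasiconvexGLPos {n : ℕ} (W : Matrix (Fin n) (Fin n) ℝ → ℝ) : Prop :=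
  IsQuasiconvex (extendGLPos W)

/-- A function that is twice (Fréchet) differentiable at each point of an open set `s`. -/
def TwiceDifferentiableOn {E : Type*} [NormedAddCommGroup E] [NormedSpace ℝ E]
    (g : E → ℝ) (s : Set E) : Prop :=
  ∀ x ∈ s, DifferentiableAt ℝ g x ∧ DifferentiableAt ℝ (fderiv ℝ g) x

/-! ### The volumetric-isochoric split in the plane -/

/-- The larger singular value of a `2 × 2` matrix. -/
def sv₁ (F : Matrix (Fin 2) (Fin 2) ℝ) : ℝ := (Matrix.toEuclideanLin F).singularValues 0

/-- The smaller singular value of a `2 × 2` matrix. -/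
def sv₂ (F : Matrix (Fin 2) (Fin 2) ℝ) : ℝ := (Matrix.toEuclideanLin F).singularValues 1

/-- The energy `F ↦ h(λ₁/λ₂) + f(λ₁ λ₂)`. It is used for `h` with `h t = h t⁻¹`, so that the order
of the singular values `λ₁, λ₂` of `F` does not matter. -/
def splitEnergy (h f : ℝ → ℝ) (F : Matrix (Fin 2) (Fin 2) ℝ) : ℝ :=
  h (sv₁ F / sv₂ F) + f (sv₁ F * sv₂ F)

end VolIso

end

noncomputable section

namespace VolIso

/-! ### Singular values of `2 × 2` matrices -/

/-! Two facts drive the proof: the distortion `λ₁ / λ₂` does not change under `F ↦ a • F`, and `det`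
is affine along rank-one lines with `∫ det (F₀ + ∇θ) = |Ω| det F₀`.

Let `k` be the isochoric part along a rank-one line, `d` the determinant at a point of it and `δ`
the slope of the determinant. Scaling the line so that this determinant becomes an arbitrary `z > 0`
leaves `k` unchanged, so rank-one convexity of `W` gives `0 ≤ k'' + (δ / d) ^ 2 * (z ^ 2 * f'' z)`
for every `z` (`second_deriv_add_nonneg`). A line with `δ ≠ 0` shows that the infimum `-c` of `z ^ 2
* f'' z` is finite. For `c * log` that expression is constantly `-c`, so the infimum of the
inequalities is exactly what rank-one convexity of `W₀` requires (`isRankOneConvexGLPos_log`).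

By the choice of `c`, `f - c * log` is convex, so `W - W₀` is a convex function of the determinant
and lies above its tangent, a null Lagrangian. Quasiconvexity of `W₀` would therefore pass to `W`
(`isQuasiconvexGLPos_of_log`).

If `c = 0`, the isochoric part alone is rank-one convex. Then `h` is convex on `(0, ∞)` and, by its
symmetry, nondecreasing on `[1, ∞)`. As `λ₁ / λ₂` is polyconvex, so is `h (λ₁ / λ₂)`, and it is
quasiconvex (`isQuasiconvexGLPos_isochoric`), a contradiction. The rest is division by `|c|`.

Every quasiconvexity claim about a nonzero energy goes through the comparison principle
`IsQuasiconvexGLPos.of_support`. -/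

theorem adjoint_comp_toEuclideanLin (F : Matrix (Fin 2) (Fin 2) ℝ) :
    (Matrix.toEuclideanLin F).adjoint ∘ₗ Matrix.toEuclideanLin F =
      Matrix.toEuclideanLin (F.transpose * F) := by
  rw [← Matrix.toEuclideanLin_conjTranspose_eq_adjoint, Matrix.conjTranspose_eq_transpose_of_trivial]
  ext v i
  simp [Matrix.toLpLin_apply]

theorem sv₁_nonneg (F : Matrix (Fin 2) (Fin 2) ℝ) : 0 ≤ sv₁ F :=
  LinearMap.singularValues_nonneg _ _

theorem sv₂_nonneg (F : Matrix (Fin 2) (Fin 2) ℝ) : 0 ≤ sv₂ F :=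
  LinearMap.singularValues_nonneg _ _

theorem sv₂_le_sv₁ (F : Matrix (Fin 2) (Fin 2) ℝ) : sv₂ F ≤ sv₁ F :=
  LinearMap.singularValues_antitone _ zero_le_one

theorem trace_toEuclideanLin (A : Matrix (Fin 2) (Fin 2) ℝ) :
    LinearMap.trace ℝ _ (Matrix.toEuclideanLin A) = A.trace := by
  rw [show Matrix.toEuclideanLin A = _ from
    congrArg (· A) (Matrix.toLpLin_eq_toLin (m := Fin 2) (n := Fin 2) 2 2), Matrix.trace_toLin_eq]

theorem det_toEuclideanLin (A : Matrix (Fin 2) (Fin 2) ℝ) :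
    LinearMap.det (Matrix.toEuclideanLin A) = A.det := by
  rw [show Matrix.toEuclideanLin A = _ from
    congrArg (· A) (Matrix.toLpLin_eq_toLin (m := Fin 2) (n := Fin 2) 2 2), LinearMap.det_toLin]

theorem sv₁_sq_add_sv₂_sq (F : Matrix (Fin 2) (Fin 2) ℝ) :
    sv₁ F ^ 2 + sv₂ F ^ 2 = F 0 0 ^ 2 + F 0 1 ^ 2 + F 1 0 ^ 2 + F 1 1 ^ 2 := by
  have hn : Module.finrank ℝ (EuclideanSpace ℝ (Fin 2)) = 2 := by simp
  have h := (Matrix.toEuclideanLin F).isSymmetric_adjoint_comp_self.trace_eq_sum_eigenvalues hn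
  simp only [Fin.sum_univ_two, ← LinearMap.sq_singularValues_fin] at h
  rw [adjoint_comp_toEuclideanLin, trace_toEuclideanLin] at h
  simp [Matrix.trace, Matrix.mul_apply, Fin.sum_univ_two] at h
  simp only [sv₁, sv₂]
  linarith

theorem sv₁_mul_sv₂_sq (F : Matrix (Fin 2) (Fin 2) ℝ) : (sv₁ F * sv₂ F) ^ 2 = F.det ^ 2 := by
  have hn : Module.finrank ℝ (EuclideanSpace ℝ (Fin 2)) = 2 := by simp
  have h := (Matrix.toEuclideanLin F).isSymmetric_adjoint_comp_self.det_eq_prod_eigenvalues hn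
  simp only [Fin.prod_univ_two, ← LinearMap.sq_singularValues_fin] at h
  rw [adjoint_comp_toEuclideanLin, det_toEuclideanLin] at h
  simp at h
  simp only [sv₁, sv₂]
  linarith

theorem sv₁_mul_sv₂ {F : Matrix (Fin 2) (Fin 2) ℝ} (hF : 0 < F.det) : sv₁ F * sv₂ F = F.det := by
  have h := sv₁_mul_sv₂_sq F
  rwa [sq_eq_sq₀ (mul_nonneg (sv₁_nonneg F) (sv₂_nonneg F)) hF.le] at h

theorem sv₁_pos {F : Matrix (Fin 2) (Fin 2) ℝ} (hF : 0 < F.det) : 0 < sv₁ F := by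
  refine (sv₁_nonneg F).lt_of_ne fun h => ?_
  rw [← sv₁_mul_sv₂ hF, ← h] at hF
  simp at hF

theorem sv₂_pos {F : Matrix (Fin 2) (Fin 2) ℝ} (hF : 0 < F.det) : 0 < sv₂ F := by
  refine (sv₂_nonneg F).lt_of_ne fun h => ?_
  rw [← sv₁_mul_sv₂ hF, ← h] at hF
  simp at hF

theorem splitEnergy_of_det_pos (h f : ℝ → ℝ) {F : Matrix (Fin 2) (Fin 2) ℝ} (hF : 0 < F.det) :
    splitEnergy h f F = h (sv₁ F / sv₂ F) + f F.det := by
  rw [splitEnergy, sv₁_mul_sv₂ hF]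

/-- The distortion `λ₁ / λ₂` is determined by `|F|² / det F`. -/
theorem distortion_add_inv {F : Matrix (Fin 2) (Fin 2) ℝ} (hF : 0 < F.det) :
    sv₁ F / sv₂ F + (sv₁ F / sv₂ F)⁻¹ =
      (F 0 0 ^ 2 + F 0 1 ^ 2 + F 1 0 ^ 2 + F 1 1 ^ 2) / F.det := by
  have h1 := sv₁_pos hF
  have h2 := sv₂_pos hF
  rw [← sv₁_sq_add_sv₂_sq, ← sv₁_mul_sv₂ hF]
  field_simp

/-- Injectivity of `t + t⁻¹` on `[1, ∞)` lets the distortion be computed from `|F|² / det F`,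
without diagonalizing. -/
theorem eq_of_add_inv_eq {s t : ℝ} (hs : 1 ≤ s) (ht : 1 ≤ t) (h : s + s⁻¹ = t + t⁻¹) : s = t := by
  have hs0 : s ≠ 0 := by positivity
  have ht0 : t ≠ 0 := by positivity
  field_simp at h
  have : (s - t) * (s * t - 1) = 0 := by linarith
  rcases mul_eq_zero.1 this with h | h
  · linarith
  · nlinarith

theorem one_le_distortion {F : Matrix (Fin 2) (Fin 2) ℝ} (hF : 0 < F.det) :
    1 ≤ sv₁ F / sv₂ F := (one_le_div (sv₂_pos hF)).2 (sv₂_le_sv₁ F)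

theorem distortion_smul {F : Matrix (Fin 2) (Fin 2) ℝ} (hF : 0 < F.det) {a : ℝ} (ha : 0 < a) :
    sv₁ (a • F) / sv₂ (a • F) = sv₁ F / sv₂ F := by
  have hd : (a • F).det = a ^ 2 * F.det := by simp
  have hF' : 0 < (a • F).det := by rw [hd]; positivity
  refine eq_of_add_inv_eq (one_le_distortion hF') (one_le_distortion hF) ?_
  rw [distortion_add_inv hF, distortion_add_inv hF', hd]
  simp only [Matrix.smul_apply, smul_eq_mul]
  field_simp

theorem distortion_diag {t : ℝ} (ht : 1 ≤ t) {a : ℝ} (ha : 0 < a) :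
    sv₁ !![a * t, 0; 0, a] / sv₂ !![a * t, 0; 0, a] = t := by
  have ht0 : 0 < t := by positivity
  have hd : Matrix.det !![a * t, 0; 0, a] = a ^ 2 * t := by simp [Matrix.det_fin_two]; ring
  have hF : 0 < Matrix.det !![a * t, 0; 0, a] := by rw [hd]; positivity
  refine eq_of_add_inv_eq (one_le_distortion hF) ht ?_
  rw [distortion_add_inv hF, hd]
  simp
  field_simp

theorem distortion_diag_inv {t : ℝ} (ht0 : 0 < t) (ht : t ≤ 1) {a : ℝ} (ha : 0 < a) :
    sv₁ !![a * t, 0; 0, a] / sv₂ !![a * t, 0; 0, a] = t⁻¹ := by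
  have hd : Matrix.det !![a * t, 0; 0, a] = a ^ 2 * t := by simp [Matrix.det_fin_two]; ring
  have hF : 0 < Matrix.det !![a * t, 0; 0, a] := by rw [hd]; positivity
  refine eq_of_add_inv_eq (one_le_distortion hF) ((one_le_inv₀ ht0).2 ht) ?_
  rw [distortion_add_inv hF, hd]
  simp
  field_simp
  ring

theorem splitEnergy_diag {h : ℝ → ℝ} (h_symm : ∀ t : ℝ, 0 < t → h t = h t⁻¹) (f : ℝ → ℝ)
    {t : ℝ} (ht : 0 < t) {a : ℝ} (ha : 0 < a) :
    splitEnergy h f !![a * t, 0; 0, a] = h t + f (a ^ 2 * t) := by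
  have hd : Matrix.det !![a * t, 0; 0, a] = a ^ 2 * t := by simp [Matrix.det_fin_two]; ring
  have hF : 0 < Matrix.det !![a * t, 0; 0, a] := by rw [hd]; positivity
  rw [splitEnergy_of_det_pos _ _ hF, hd]
  rcases le_total 1 t with h1 | h1
  · rw [distortion_diag h1 ha]
  · rw [distortion_diag_inv ht h1 ha, h_symm t ht]

/-! ### Supporting planes of the larger singular value and of the distortion -/

theorem exists_dual_vector_sqrt (u v : ℝ) :
    ∃ a b : ℝ, a * u + b * v = √(u ^ 2 + v ^ 2) ∧ ∀ x y : ℝ, a * x + b * y ≤ √(x ^ 2 + y ^ 2) := by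
  rcases (Real.sqrt_nonneg (u ^ 2 + v ^ 2)).eq_or_lt with h | h
  · refine ⟨0, 0, by simp [← h], fun x y => by simp⟩
  · have hs : √(u ^ 2 + v ^ 2) ^ 2 = u ^ 2 + v ^ 2 := Real.sq_sqrt (by positivity)
    set r := √(u ^ 2 + v ^ 2)
    refine ⟨u / r, v / r, by field_simp; linarith, fun x y => ?_⟩
    refine Real.le_sqrt_of_sq_le ?_
    have : u / r * x + v / r * y = (u * x + v * y) / r := by ring
    rw [this, div_pow, div_le_iff₀ (by positivity), hs]
    nlinarith [sq_nonneg (u * y - v * x)]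

/-- The sum and the difference of the singular values are Euclidean norms of linear images of `F`,
its conformal and anticonformal parts. Half the sum of the two norms is `λ₁`, which is thus convex.
-/
theorem sv₁_add_sv₂ {F : Matrix (Fin 2) (Fin 2) ℝ} (hF : 0 < F.det) :
    sv₁ F + sv₂ F = √((F 0 0 + F 1 1) ^ 2 + (F 1 0 - F 0 1) ^ 2) := by
  rw [eq_comm, Real.sqrt_eq_iff_eq_sq (by positivity) (add_nonneg (sv₁_nonneg F) (sv₂_nonneg F))]
  have h1 := sv₁_sq_add_sv₂_sq F
  have h2 := sv₁_mul_sv₂ hF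
  rw [Matrix.det_fin_two] at h2
  linear_combination -h1 - 2 * h2

theorem sv₁_sub_sv₂ {F : Matrix (Fin 2) (Fin 2) ℝ} (hF : 0 < F.det) :
    sv₁ F - sv₂ F = √((F 0 0 - F 1 1) ^ 2 + (F 1 0 + F 0 1) ^ 2) := by
  rw [eq_comm, Real.sqrt_eq_iff_eq_sq (by positivity) (sub_nonneg.2 (sv₂_le_sv₁ F))]
  have h1 := sv₁_sq_add_sv₂_sq F
  have h2 := sv₁_mul_sv₂ hF
  rw [Matrix.det_fin_two] at h2
  linear_combination -h1 + 2 * h2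

/-- The larger singular value is the supremum of linear functions. -/
theorem exists_support_sv₁ {F₀ : Matrix (Fin 2) (Fin 2) ℝ} (hF₀ : 0 < F₀.det) :
    ∃ B : Fin 2 → Fin 2 → ℝ, ∀ F : Matrix (Fin 2) (Fin 2) ℝ, 0 < F.det →
      sv₁ F₀ + ∑ i, ∑ j, B i j * (F i j - F₀ i j) ≤ sv₁ F := by
  obtain ⟨a, b, h0, h⟩ := exists_dual_vector_sqrt (F₀ 0 0 + F₀ 1 1) (F₀ 1 0 - F₀ 0 1)
  obtain ⟨a', b', h0', h'⟩ := exists_dual_vector_sqrt (F₀ 0 0 - F₀ 1 1) (F₀ 1 0 + F₀ 0 1)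
  rw [← sv₁_add_sv₂ hF₀] at h0
  rw [← sv₁_sub_sv₂ hF₀] at h0'
  refine ⟨!![(a + a') / 2, (b' - b) / 2; (b + b') / 2, (a - a') / 2], fun F hF => ?_⟩
  have h1 := h (F 0 0 + F 1 1) (F 1 0 - F 0 1)
  have h1' := h' (F 0 0 - F 1 1) (F 1 0 + F 0 1)
  rw [← sv₁_add_sv₂ hF] at h1
  rw [← sv₁_sub_sv₂ hF] at h1'
  simp [Fin.sum_univ_two]
  linarith

/-- Tangent plane of the polyconvex function `F ↦ λ₁ / λ₂` at a matrix of positive determinant. -/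
theorem exists_tangent_distortion {F₀ : Matrix (Fin 2) (Fin 2) ℝ} (hF₀ : 0 < F₀.det) :
    ∃ (A : Fin 2 → Fin 2 → ℝ) (m : ℝ), ∀ F : Matrix (Fin 2) (Fin 2) ℝ, 0 < F.det →
      sv₁ F₀ / sv₂ F₀ + ∑ i, ∑ j, A i j * (F i j - F₀ i j) + m * (F.det - F₀.det) ≤
        sv₁ F / sv₂ F := by
  obtain ⟨B, hB⟩ := exists_support_sv₁ hF₀
  have h1 := sv₁_pos hF₀
  have h2 := sv₂_pos hF₀
  -- On `GL⁺(2)` the distortion is `λ₁² / det F`. The coefficients are the partial derivatives of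
  -- the convex function `x² / y` at `(λ₁, det F₀)`; the square in `h6` is its convexity gap.
  refine ⟨fun i j => 2 * (1 / sv₂ F₀) * B i j, -(1 / sv₂ F₀) ^ 2, fun F hF => ?_⟩
  have h3 := sv₁_pos hF
  have h4 := sv₂_pos hF
  have h5 := mul_le_mul_of_nonneg_left (hB F hF) (show 0 ≤ 2 * (1 / sv₂ F₀) by positivity)
  have h6 : 0 ≤ sv₁ F * sv₂ F * (1 / sv₂ F - 1 / sv₂ F₀) ^ 2 := by positivity
  have h7 : sv₁ F * sv₂ F * (1 / sv₂ F - 1 / sv₂ F₀) ^ 2 =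
      sv₁ F / sv₂ F - 2 * (1 / sv₂ F₀) * sv₁ F + (1 / sv₂ F₀) ^ 2 * F.det := by
    rw [← sv₁_mul_sv₂ hF]; field_simp; ring
  have h8 : sv₁ F₀ / sv₂ F₀ = 2 * (1 / sv₂ F₀) * sv₁ F₀ - (1 / sv₂ F₀) ^ 2 * F₀.det := by
    rw [← sv₁_mul_sv₂ hF₀]; field_simp; ring
  simp only [mul_assoc, Finset.mul_sum, mul_add] at h5 ⊢
  linarith

/-! ### Rank-one lines -/

theorem det_eq_zero_of_rank_eq_one {H : Matrix (Fin 2) (Fin 2) ℝ} (hH : H.rank = 1) :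
    H.det = 0 := by
  by_contra h
  have := Matrix.rank_of_det_ne_zero h
  rw [hH] at this
  simp at this

theorem rank_smul_eq_one {H : Matrix (Fin 2) (Fin 2) ℝ} (hH : H.rank = 1) {a : ℝ} (ha : a ≠ 0) :
    (a • H).rank = 1 := by
  rwa [Matrix.rank_smul_of_mem_nonZeroDivisors H (mem_nonZeroDivisors_of_ne_zero ha)]

/-- The derivative of the determinant at `F` in the direction `H`. -/
def detSlope (F H : Matrix (Fin 2) (Fin 2) ℝ) : ℝ :=
  F 0 0 * H 1 1 + F 1 1 * H 0 0 - F 0 1 * H 1 0 - F 1 0 * H 0 1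

theorem det_add_smul (F : Matrix (Fin 2) (Fin 2) ℝ) {H : Matrix (Fin 2) (Fin 2) ℝ}
    (hH : H.rank = 1) (t : ℝ) : (F + t • H).det = F.det + t * detSlope F H := by
  have h := det_eq_zero_of_rank_eq_one hH
  rw [Matrix.det_fin_two] at h ⊢
  rw [Matrix.det_fin_two]
  simp only [Matrix.add_apply, Matrix.smul_apply, smul_eq_mul, detSlope]
  linear_combination t ^ 2 * h

/-- The parameters for which the line `F + t H` lies in `GL⁺(2)`. -/
def posSet (F H : Matrix (Fin 2) (Fin 2) ℝ) : Set ℝ := {t | 0 < (F + t • H).det}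

theorem posSet_eq (F : Matrix (Fin 2) (Fin 2) ℝ) {H : Matrix (Fin 2) (Fin 2) ℝ}
    (hH : H.rank = 1) : posSet F H = {t | 0 < F.det + t * detSlope F H} := by
  ext t
  simp [posSet, det_add_smul F hH]

theorem isOpen_posSet (F : Matrix (Fin 2) (Fin 2) ℝ) {H : Matrix (Fin 2) (Fin 2) ℝ}
    (hH : H.rank = 1) : IsOpen (posSet F H) := by
  rw [posSet_eq F hH]
  exact isOpen_lt continuous_const (by fun_prop)

theorem convex_posSet (F : Matrix (Fin 2) (Fin 2) ℝ) {H : Matrix (Fin 2) (Fin 2) ℝ}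
    (hH : H.rank = 1) : Convex ℝ (posSet F H) := by
  rw [posSet_eq F hH]
  intro s hs t ht a b ha hb hab
  simp only [Set.mem_ofPred_eq, smul_eq_mul] at *
  have : F.det + (a * s + b * t) * detSlope F H =
      a * (F.det + s * detSlope F H) + b * (F.det + t * detSlope F H) := by
    linear_combination -F.det * hab
  rw [this]
  rcases ha.eq_or_lt with rfl | ha
  · have : b = 1 := by linarith
    subst this; simpa using ht
  · positivity

/-- An endpoint outside `GL⁺(2)` makes the right side `⊤`, so only segments with both ends inside
matter; these stay inside because the determinant is affine on them. -/
theorem isRankOneConvexGLPos_iff (V : Matrix (Fin 2) (Fin 2) ℝ → ℝ) :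
    IsRankOneConvexGLPos V ↔ ∀ F H : Matrix (Fin 2) (Fin 2) ℝ, H.rank = 1 →
      ConvexOn ℝ (posSet F H) (fun t => V (F + t • H)) := by
  constructor
  · intro hV F H hH
    refine ⟨convex_posSet F hH, fun s hs t ht a b ha hb hab => ?_⟩
    have hst := convex_posSet F hH hs ht ha hb hab
    rcases ha.eq_or_lt with rfl | ha
    · have : b = 1 := by linarith
      subst this; simp
    rcases hb.eq_or_lt with rfl | hb
    · have : a = 1 := by linarith
      subst this; simp
    -- Coinciding endpoints differ by a matrix of rank zero, which the definition does not cover.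
    by_cases h : s = t
    · subst h
      simp only [← add_smul, hab, one_smul]
      exact le_rfl
    have hr : ((F + s • H) - (F + t • H)).rank = 1 := by
      rw [add_sub_add_left_eq_sub, ← sub_smul]
      exact rank_smul_eq_one hH (sub_ne_zero.2 h)
    have key := hV _ _ hr a ha (by linarith)
    have e : a • (F + s • H) + (1 - a) • (F + t • H) = F + (a * s + b * t) • H := by
      rw [show b = 1 - a by linarith]; module
    simp only [posSet, Set.mem_ofPred_eq, smul_eq_mul] at hs ht hst
    rw [e, show 1 - a = b by linarith] at key
    simp only [extendGLPos, hs, ht, hst, if_true] at key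
    exact_mod_cast key
  · intro hV F₁ F₂ hr t h0 h1
    by_cases hd1 : 0 < F₁.det
    swap
    · rw [extendGLPos.eq_def V F₁, if_neg hd1, EReal.coe_mul_top_of_pos h0, EReal.top_add_of_ne_bot]
      · exact le_top
      · unfold extendGLPos
        split_ifs
        · exact_mod_cast EReal.coe_ne_bot _
        · rw [EReal.coe_mul_top_of_pos (by linarith)]; simp
    by_cases hd2 : 0 < F₂.det
    swap
    · rw [extendGLPos.eq_def V F₂, if_neg hd2, EReal.coe_mul_top_of_pos (sub_pos.2 h1),
        EReal.add_top_of_ne_bot]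
      · exact le_top
      · unfold extendGLPos
        split_ifs
        · exact_mod_cast EReal.coe_ne_bot _
    have m1 : (1 : ℝ) ∈ posSet F₂ (F₁ - F₂) := by simpa [posSet] using hd1
    have m0 : (0 : ℝ) ∈ posSet F₂ (F₁ - F₂) := by simpa [posSet] using hd2
    have e : t • F₁ + (1 - t) • F₂ = F₂ + t • (F₁ - F₂) := by module
    have key := (hV F₂ (F₁ - F₂) hr).2 m1 m0 h0.le (sub_pos.2 h1).le (by ring)
    have m := (hV F₂ (F₁ - F₂) hr).1 m1 m0 h0.le (sub_pos.2 h1).le (by ring)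
    simp only [posSet, Set.mem_ofPred_eq, smul_eq_mul, mul_one, mul_zero, add_zero, one_smul,
      zero_smul, add_sub_cancel] at key m
    rw [e]
    simp only [extendGLPos, hd1, hd2, m, if_true]
    exact_mod_cast key

/-! ### Twice differentiable functions -/

theorem TwiceDifferentiableOn.comp {E F : Type*} [NormedAddCommGroup E] [NormedSpace ℝ E]
    [NormedAddCommGroup F] [NormedSpace ℝ F] {g : F → ℝ} {s : Set F} {γ : E → F} {I : Set E}
    (hg : TwiceDifferentiableOn g s) (hI : IsOpen I) (hγ : ContDiffOn ℝ 2 γ I)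
    (hm : Set.MapsTo γ I s) : TwiceDifferentiableOn (fun x => g (γ x)) I := by
  intro x hx
  have hγ' : ∀ y ∈ I, DifferentiableAt ℝ γ y := fun y hy =>
    (hγ.contDiffAt (hI.mem_nhds hy)).differentiableAt (by norm_num)
  refine ⟨(hg _ (hm hx)).1.comp x (hγ' x hx), ?_⟩
  have e : fderiv ℝ (fun x => g (γ x)) =ᶠ[𝓝 x]
      fun y => (fderiv ℝ g (γ y)).comp (fderiv ℝ γ y) := by
    filter_upwards [hI.mem_nhds hx] with y hy
    exact fderiv_comp y (hg _ (hm hy)).1 (hγ' y hy)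
  refine DifferentiableAt.congr_of_eventuallyEq ?_ e
  have h2 : DifferentiableAt ℝ (fderiv ℝ γ) x :=
    ((hγ.contDiffAt (hI.mem_nhds hx)).fderiv_right (m := 1) (by norm_num)).differentiableAt
      (by norm_num)
  exact ((hg _ (hm hx)).2.comp x (hγ' x hx)).clm_comp h2

theorem TwiceDifferentiableOn.hasDerivAt {g : ℝ → ℝ} {s : Set ℝ} (hg : TwiceDifferentiableOn g s)
    {x : ℝ} (hx : x ∈ s) :
    HasDerivAt g (deriv g x) x ∧ HasDerivAt (deriv g) (deriv (deriv g) x) x := by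
  refine ⟨(hg x hx).1.hasDerivAt, DifferentiableAt.hasDerivAt ?_⟩
  have : deriv g = fun y => fderiv ℝ g y 1 := by ext y; simp
  rw [this]
  exact (hg x hx).2.clm_apply (differentiableAt_const _)

theorem TwiceDifferentiableOn.sub_const {E : Type*} [NormedAddCommGroup E] [NormedSpace ℝ E]
    {g : E → ℝ} {s : Set E} (hg : TwiceDifferentiableOn g s) (c : ℝ) :
    TwiceDifferentiableOn (fun x => g x - c) s := by
  intro x hx
  refine ⟨(hg x hx).1.sub_const c, ?_⟩
  have : fderiv ℝ (fun x => g x - c) = fderiv ℝ g := by ext1 y; exact fderiv_sub_const _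
  rw [this]
  exact (hg x hx).2

theorem TwiceDifferentiableOn.congr {E : Type*} [NormedAddCommGroup E] [NormedSpace ℝ E]
    {g g₁ : E → ℝ} {s : Set E} (hg : TwiceDifferentiableOn g s) (hs : IsOpen s)
    (h : Set.EqOn g₁ g s) : TwiceDifferentiableOn g₁ s := by
  intro x hx
  have e := h.eventuallyEq_of_mem (hs.mem_nhds hx)
  exact ⟨(hg x hx).1.congr_of_eventuallyEq e, (hg x hx).2.congr_of_eventuallyEq e.fderiv⟩

theorem second_deriv_nonneg_of_convexOn {g g' : ℝ → ℝ} {I : Set ℝ} (hI : IsOpen I)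
    (hg : ConvexOn ℝ I g) (h1 : ∀ x ∈ I, HasDerivAt g (g' x) x) {x g'' : ℝ} (hx : x ∈ I)
    (h2 : HasDerivAt g' g'' x) : 0 ≤ g'' := by
  have hm : MonotoneOn g' I := by
    intro y hy z hz hyz
    have := hg.monotoneOn_deriv (fun x hx => (h1 x hx).differentiableAt) hy hz hyz
    rwa [(h1 y hy).deriv, (h1 z hz).deriv] at this
  rw [← h2.deriv, ← derivWithin_of_mem_nhds (hI.mem_nhds hx)]
  exact hm.derivWithin_nonneg

theorem tangent_le_of_convexOn {g : ℝ → ℝ} {I : Set ℝ} (hg : ConvexOn ℝ I g) {x y g' : ℝ}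
    (hx : x ∈ I) (hy : y ∈ I) (h1 : HasDerivAt g g' x) : g x + g' * (y - x) ≤ g y := by
  rcases lt_trichotomy x y with h | rfl | h
  · have := hg.le_slope_of_hasDerivAt hx hy h h1
    rw [slope_def_field, le_div_iff₀ (sub_pos.2 h)] at this
    linarith
  · simp
  · have := hg.slope_le_of_hasDerivAt hy hx h h1
    rw [slope_def_field, div_le_iff₀ (sub_pos.2 h)] at this
    linarith

/-! ### Rank-one convexity of the reduced energy -/

theorem rank_diag_one_zero : (!![1, 0; 0, 0] : Matrix (Fin 2) (Fin 2) ℝ).rank = 1 := by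
  have : (!![1, 0; 0, 0] : Matrix (Fin 2) (Fin 2) ℝ) = Matrix.vecMulVec ![1, 0] ![1, 0] := by
    ext i j; fin_cases i <;> fin_cases j <;> simp [Matrix.vecMulVec]
  refine le_antisymm (this ▸ Matrix.rank_vecMulVec_le _ _) (Nat.one_le_iff_ne_zero.2 fun h0 => ?_)
  rw [Matrix.rank, Submodule.finrank_eq_zero, LinearMap.range_eq_bot] at h0
  have := congrFun (LinearMap.congr_fun h0 ![1, 0]) 0
  simp [Matrix.mulVec, dotProduct] at this

section Reduction

variable {W : Matrix (Fin 2) (Fin 2) ℝ → ℝ} {h f : ℝ → ℝ}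

theorem twiceDifferentiableOn_volumetric (h_symm : ∀ t : ℝ, 0 < t → h t = h t⁻¹)
    (h_split : ∀ F : Matrix (Fin 2) (Fin 2) ℝ, 0 < F.det → W F = splitEnergy h f F)
    (h_diff : TwiceDifferentiableOn W {F : Matrix (Fin 2) (Fin 2) ℝ | 0 < F.det}) :
    TwiceDifferentiableOn f (Set.Ioi 0) := by
  -- On the multiples `√z • 1` of the identity the distortion stays `1` and the determinant is `z`,
  -- so `f` is `W` along this curve minus `h 1`.
  have hd : ∀ z : ℝ, Matrix.det !![√z * 1, 0; 0, √z] = √z * √z := by simp [Matrix.det_fin_two]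
  have hm : Set.MapsTo (fun z : ℝ => (!![√z * 1, 0; 0, √z] : Matrix (Fin 2) (Fin 2) ℝ))
      (Set.Ioi 0) {F | 0 < F.det} := by
    intro z (hz : 0 < z)
    have := Real.sqrt_pos.2 hz
    rw [Set.mem_ofPred_eq, hd]; positivity
  have hγ : ContDiffOn ℝ 2 (fun z : ℝ => (!![√z * 1, 0; 0, √z] : Matrix (Fin 2) (Fin 2) ℝ))
      (Set.Ioi 0) := by
    have hs : ContDiffOn ℝ 2 (fun z : ℝ => √z) (Set.Ioi 0) := fun z (hz : 0 < z) =>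
      (Real.contDiffAt_sqrt hz.ne').contDiffWithinAt
    refine contDiffOn_pi.2 fun i => contDiffOn_pi.2 fun j => ?_
    fin_cases i <;> fin_cases j <;> simp [hs, contDiffOn_const]
  refine ((h_diff.comp isOpen_Ioi hγ hm).sub_const (h 1)).congr isOpen_Ioi fun z (hz : 0 < z) => ?_
  have hz' := Real.sqrt_pos.2 hz
  show f z = W _ - h 1
  rw [h_split _ (hm hz), splitEnergy_diag h_symm f one_pos hz', mul_one, Real.sq_sqrt hz.le]
  ring

/-- If the isochoric and the volumetric parts of a rank-one convex energy are restricted to a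
rank-one line, then scaling the line decouples their second derivatives. -/
theorem second_deriv_add_nonneg
    (h_split : ∀ F : Matrix (Fin 2) (Fin 2) ℝ, 0 < F.det → W F = splitEnergy h f F)
    (h_roc : IsRankOneConvexGLPos W) (hf : TwiceDifferentiableOn f (Set.Ioi 0))
    {F H : Matrix (Fin 2) (Fin 2) ℝ} (hH : H.rank = 1) {k k' k'' : ℝ → ℝ}
    (hk : ∀ t ∈ posSet F H, k t = h (sv₁ (F + t • H) / sv₂ (F + t • H)))
    (hk' : ∀ t ∈ posSet F H, HasDerivAt k (k' t) t)
    (hk'' : ∀ t ∈ posSet F H, HasDerivAt k' (k'' t) t) {t : ℝ} (ht : t ∈ posSet F H)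
    {z : ℝ} (hz : 0 < z) :
    0 ≤ k'' t + (detSlope F H / (F + t • H).det) ^ 2 * (z ^ 2 * deriv (deriv f) z) := by
  have hdt : 0 < (F + t • H).det := ht
  set δ := detSlope F H
  -- Scaling matrices by `√a` multiplies determinants by `a`, which moves the determinant at
  -- parameter `t` to `z`.
  set a := z / (F + t • H).det
  have ha : 0 < a := by positivity
  have hconv : ConvexOn ℝ (posSet F H) (fun s => k s + f (a * (F.det + s * δ))) := by
    have hb : 0 < √a := Real.sqrt_pos.2 ha
    have h1 := (isRankOneConvexGLPos_iff W).1 h_roc (√a • F) (√a • H)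
      (rank_smul_eq_one hH hb.ne')
    have e : ∀ s : ℝ, √a • F + s • √a • H = √a • (F + s • H) := fun s => by module
    have ed : ∀ s : ℝ, (√a • (F + s • H)).det = a * (F + s • H).det := fun s => by
      rw [Matrix.det_smul, Fintype.card_fin, Real.sq_sqrt ha.le]
    have e2 : posSet (√a • F) (√a • H) = posSet F H := by
      ext s
      simp only [posSet, Set.mem_ofPred_eq, e, ed]
      exact mul_pos_iff_of_pos_left ha
    rw [e2] at h1
    refine h1.congr fun s hs => ?_
    have hs' : 0 < (F + s • H).det := hs
    have hs2 : 0 < (√a • (F + s • H)).det := by rw [ed]; positivity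
    simp only [e]
    rw [h_split _ hs2, splitEnergy_of_det_pos _ _ hs2, distortion_smul hs' hb, hk s hs, ed,
      det_add_smul F hH]
  have hpos : ∀ s ∈ posSet F H, a * (F.det + s * δ) ∈ Set.Ioi (0 : ℝ) := fun s hs => by
    have hs' : 0 < (F + s • H).det := hs
    rw [det_add_smul F hH] at hs'
    exact mul_pos ha hs'
  have haff : ∀ s : ℝ, HasDerivAt (fun s => a * (F.det + s * δ)) (a * δ) s := fun s => by
    simpa using (((hasDerivAt_id s).mul_const δ).const_add F.det).const_mul a
  have d1 : ∀ s ∈ posSet F H, HasDerivAt (fun s => k s + f (a * (F.det + s * δ)))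
      (k' s + deriv f (a * (F.det + s * δ)) * (a * δ)) s := fun s hs =>
    (hk' s hs).add ((hf.hasDerivAt (hpos s hs)).1.comp s (haff s))
  have d2 : HasDerivAt (fun s => k' s + deriv f (a * (F.det + s * δ)) * (a * δ))
      (k'' t + deriv (deriv f) (a * (F.det + t * δ)) * (a * δ) * (a * δ)) t :=
    (hk'' t ht).add
      (((hf.hasDerivAt (hpos t ht)).2.comp t (haff t)).mul_const (a * δ))
  have key := second_deriv_nonneg_of_convexOn (isOpen_posSet F hH) hconv d1 ht d2
  have ez : a * (F.det + t * δ) = z := by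
    rw [← det_add_smul F hH]
    exact div_mul_cancel₀ _ hdt.ne'
  rw [ez] at key
  convert key using 2
  simp only [a]
  field_simp

/-- Singular values need not be smooth where they coincide, so the isochoric part gets its two
derivatives as the difference of `W` and the volumetric part. -/
theorem hasDerivAt_line (h_diff : TwiceDifferentiableOn W {F | 0 < F.det})
    (hf : TwiceDifferentiableOn f (Set.Ioi 0)) (F : Matrix (Fin 2) (Fin 2) ℝ)
    {H : Matrix (Fin 2) (Fin 2) ℝ} (hH : H.rank = 1) :
    ∃ k' k'' : ℝ → ℝ, ∀ t ∈ posSet F H,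
      HasDerivAt (fun t => W (F + t • H) - f (F.det + t * detSlope F H)) (k' t) t ∧
      HasDerivAt k' (k'' t) t := by
  have hw : TwiceDifferentiableOn (fun t : ℝ => W (F + t • H)) (posSet F H) := by
    refine h_diff.comp (γ := fun t : ℝ => F + t • H) (isOpen_posSet F hH) ?_ fun t ht => ht
    exact (contDiff_const.add (contDiff_id.smul contDiff_const)).contDiffOn
  have hg : TwiceDifferentiableOn (fun t : ℝ => f (F.det + t * detSlope F H)) (posSet F H) := by
    refine hf.comp (γ := fun t : ℝ => F.det + t * detSlope F H) (isOpen_posSet F hH)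
      (by fun_prop) fun t ht => ?_
    rw [posSet_eq F hH] at ht
    exact ht
  exact ⟨_, _, fun t ht => ⟨(hw.hasDerivAt ht).1.sub (hg.hasDerivAt ht).1,
    (hw.hasDerivAt ht).2.sub (hg.hasDerivAt ht).2⟩⟩

theorem isochoric_eq_sub
    (h_split : ∀ F : Matrix (Fin 2) (Fin 2) ℝ, 0 < F.det → W F = splitEnergy h f F)
    {F H : Matrix (Fin 2) (Fin 2) ℝ} (hH : H.rank = 1) {t : ℝ} (ht : t ∈ posSet F H) :
    W (F + t • H) - f (F.det + t * detSlope F H) = h (sv₁ (F + t • H) / sv₂ (F + t • H)) := by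
  rw [h_split _ ht, splitEnergy_of_det_pos _ _ ht, det_add_smul F hH]
  ring

/-- On the line `1 + t e₁ ⊗ e₁` at `t = 0` the determinant and its slope are both `1`, so the
decoupled inequality bounds `z ^ 2 * f'' z` below by `-k'' 0`. -/
theorem bddBelow_volumetric
    (h_split : ∀ F : Matrix (Fin 2) (Fin 2) ℝ, 0 < F.det → W F = splitEnergy h f F)
    (h_diff : TwiceDifferentiableOn W {F | 0 < F.det}) (h_roc : IsRankOneConvexGLPos W)
    (hf : TwiceDifferentiableOn f (Set.Ioi 0)) :
    BddBelow ((fun z : ℝ => z ^ 2 * deriv (deriv f) z) '' Set.Ioi 0) := by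
  obtain ⟨k', k'', hk⟩ := hasDerivAt_line h_diff hf 1 rank_diag_one_zero
  have ht : (0 : ℝ) ∈ posSet 1 !![1, 0; 0, 0] := by
    simp [posSet_eq 1 rank_diag_one_zero]
  refine ⟨-k'' 0, ?_⟩
  rintro _ ⟨z, hz, rfl⟩
  have := second_deriv_add_nonneg h_split h_roc hf rank_diag_one_zero
    (fun t ht => isochoric_eq_sub h_split rank_diag_one_zero ht) (fun t ht => (hk t ht).1)
    (fun t ht => (hk t ht).2) ht hz
  simp [detSlope] at this
  linarith

theorem isRankOneConvexGLPos_log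
    (h_split : ∀ F : Matrix (Fin 2) (Fin 2) ℝ, 0 < F.det → W F = splitEnergy h f F)
    (h_diff : TwiceDifferentiableOn W {F | 0 < F.det}) (h_roc : IsRankOneConvexGLPos W)
    (hf : TwiceDifferentiableOn f (Set.Ioi 0)) {c : ℝ}
    (hc : IsGLB ((fun z : ℝ => z ^ 2 * deriv (deriv f) z) '' Set.Ioi 0) (-c)) :
    IsRankOneConvexGLPos (splitEnergy h (fun z => c * Real.log z)) := by
  rw [isRankOneConvexGLPos_iff]
  intro F H hH
  obtain ⟨k', k'', hk⟩ := hasDerivAt_line h_diff hf F hH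
  set δ := detSlope F H
  have hd : ∀ t ∈ posSet F H, 0 < F.det + t * δ := fun t ht => by
    rwa [posSet_eq F hH] at ht
  have haff : ∀ s : ℝ, HasDerivAt (fun s => F.det + s * δ) δ s := fun s => by
    simpa using ((hasDerivAt_id s).mul_const δ).const_add F.det
  have d1 : ∀ t ∈ posSet F H, HasDerivAt
      (fun t => (W (F + t • H) - f (F.det + t * δ)) + c * Real.log (F.det + t * δ))
      (k' t + c * (δ / (F.det + t * δ))) t := fun t ht =>
    (hk t ht).1.add (((haff t).log (hd t ht).ne').const_mul c)
  have d2 : ∀ t ∈ posSet F H, HasDerivAt (fun t => k' t + c * (δ / (F.det + t * δ)))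
      (k'' t + c * ((0 * (F.det + t * δ) - δ * δ) / (F.det + t * δ) ^ 2)) t := fun t ht =>
    (hk t ht).2.add (((hasDerivAt_const t δ).div (haff t) (hd t ht).ne').const_mul c)
  have hconv : ConvexOn ℝ (posSet F H)
      (fun t => (W (F + t • H) - f (F.det + t * δ)) + c * Real.log (F.det + t * δ)) := by
    have hint : interior (posSet F H) = posSet F H := (isOpen_posSet F hH).interior_eq
    refine convexOn_of_hasDerivWithinAt2_nonneg (convex_posSet F hH)
      (fun t ht => (d1 t ht).continuousAt.continuousWithinAt)
      (fun t ht => (d1 t (interior_subset ht)).hasDerivWithinAt)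
      (fun t ht => (d2 t (interior_subset ht)).hasDerivWithinAt) fun t ht => ?_
    rw [hint] at ht
    have hp := hd t ht
    have key : ∀ z : ℝ, 0 < z →
        0 ≤ k'' t + (δ / (F.det + t * δ)) ^ 2 * (z ^ 2 * deriv (deriv f) z) := fun z hz => by
      have := second_deriv_add_nonneg h_split h_roc hf hH
        (fun t ht => isochoric_eq_sub h_split hH ht) (fun t ht => (hk t ht).1)
        (fun t ht => (hk t ht).2) ht hz
      rwa [det_add_smul F hH] at this
    have e : k'' t + c * ((0 * (F.det + t * δ) - δ * δ) / (F.det + t * δ) ^ 2) =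
        k'' t + (δ / (F.det + t * δ)) ^ 2 * -c := by field_simp; ring
    rw [e]
    -- If the determinant is constant on the line the volumetric term drops out and any `z` serves;
    -- otherwise dividing by the square gives a lower bound that passes to the infimum `-c`.
    rcases (sq_nonneg (δ / (F.det + t * δ))).eq_or_lt with h0 | h0
    · have := key 1 one_pos
      rw [← h0] at this ⊢
      linarith
    · have hb : -k'' t / (δ / (F.det + t * δ)) ^ 2 ≤ -c := hc.2 <| by
        rintro _ ⟨z, hz, rfl⟩
        rw [div_le_iff₀ h0]
        linarith [key z hz]
      rw [div_le_iff₀ h0] at hb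
      linarith
  refine hconv.congr fun t ht => ?_
  have hp : 0 < (F + t • H).det := ht
  simp only []
  rw [isochoric_eq_sub h_split hH ht, splitEnergy_of_det_pos _ _ hp, det_add_smul F hH]

/-- The tangent inequality of the isochoric part of an energy that is rank-one convex even
without a volumetric part. -/
theorem exists_tangent_isochoric (h_symm : ∀ t : ℝ, 0 < t → h t = h t⁻¹)
    (h_roc : IsRankOneConvexGLPos (splitEnergy h (fun _ => 0)))
    (hd : ∀ t : ℝ, 0 < t → DifferentiableAt ℝ h t) {s₀ : ℝ} (hs₀ : 1 ≤ s₀) :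
    ∃ m : ℝ, 0 ≤ m ∧ ∀ s : ℝ, 0 < s → h s₀ + m * (s - s₀) ≤ h s := by
  have e : ∀ t : ℝ, !![0, 0; 0, 1] + t • !![1, 0; 0, 0] =
      (!![1 * t, 0; 0, 1] : Matrix (Fin 2) (Fin 2) ℝ) := fun t => by
    ext i j; fin_cases i <;> fin_cases j <;> simp
  have hI : posSet !![0, 0; 0, 1] !![1, 0; 0, 0] = Set.Ioi 0 := by
    ext t
    simp only [posSet, e]
    simp [Matrix.det_fin_two]
  have hc := (isRankOneConvexGLPos_iff _).1 h_roc !![0, 0; 0, 1] _ rank_diag_one_zero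
  rw [hI] at hc
  replace hc : ConvexOn ℝ (Set.Ioi 0) h := hc.congr fun t ht => by
    simp only [e]
    rw [splitEnergy_diag h_symm _ ht one_pos, add_zero]
  -- Differentiating `h t = h t⁻¹` at `1` gives `h' 1 = -h' 1`. With convexity this makes the slopes
  -- at `s₀ ≥ 1` nonnegative.
  have h0 : deriv h 1 = 0 := by
    have h1 := (hd 1 one_pos).hasDerivAt
    have h2 : HasDerivAt (fun t => h t⁻¹) (deriv h 1 * -(1 ^ 2)⁻¹) 1 :=
      HasDerivAt.comp (1 : ℝ) (by simpa using h1) (hasDerivAt_inv one_ne_zero)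
    have h3 : HasDerivAt h (deriv h 1 * -(1 ^ 2)⁻¹) 1 := h2.congr_of_eventuallyEq <| by
      filter_upwards [isOpen_Ioi.mem_nhds (Set.mem_Ioi.2 (one_pos (α := ℝ)))] with t ht
      exact h_symm t ht
    have := h1.unique h3
    linarith
  have hs₀' : 0 < s₀ := by linarith
  have ht : ∀ x y : ℝ, 0 < x → 0 < y → h x + deriv h x * (y - x) ≤ h y := fun x y hx hy =>
    tangent_le_of_convexOn hc hx hy (hd x hx).hasDerivAt
  refine ⟨deriv h s₀, ?_, fun s hs => ht s₀ s hs₀' hs⟩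
  rcases hs₀.eq_or_lt with rfl | hs₀
  · exact h0.ge
  · have h1 := ht s₀ 1 hs₀' one_pos
    have h2 := ht 1 s₀ one_pos hs₀'
    rw [h0] at h2
    have : 0 ≤ deriv h s₀ * (s₀ - 1) := by linarith
    exact nonneg_of_mul_nonneg_left this (by linarith)

theorem differentiableAt_isochoric (h_symm : ∀ t : ℝ, 0 < t → h t = h t⁻¹)
    (h_split : ∀ F : Matrix (Fin 2) (Fin 2) ℝ, 0 < F.det → W F = splitEnergy h f F)
    (h_diff : TwiceDifferentiableOn W {F | 0 < F.det})
    (hf : TwiceDifferentiableOn f (Set.Ioi 0)) {t : ℝ} (ht : 0 < t) : DifferentiableAt ℝ h t := by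
  have hp : ∀ s : ℝ, 0 < s → 0 < Matrix.det !![1 * s, 0; 0, 1] := fun s hs => by
    simpa [Matrix.det_fin_two] using hs
  have hγ : Differentiable ℝ (fun s : ℝ => (!![1 * s, 0; 0, 1] : Matrix (Fin 2) (Fin 2) ℝ)) := by
    refine differentiable_pi.2 fun i => differentiable_pi.2 fun j => ?_
    fin_cases i <;> fin_cases j <;> simp
  have h1 : DifferentiableAt ℝ (fun s : ℝ => W !![1 * s, 0; 0, 1] - f s) t :=
    ((h_diff _ (hp t ht)).1.comp t (hγ t)).sub (hf t ht).1
  refine h1.congr_of_eventuallyEq ?_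
  filter_upwards [isOpen_Ioi.mem_nhds (show t ∈ Set.Ioi 0 from ht)] with s hs
  rw [h_split _ (hp s hs), splitEnergy_diag h_symm f hs one_pos]
  simp

end Reduction

/-! ### The determinant is a null Lagrangian -/

section NullLagrangian

variable {n : ℕ} {Ω : Set (EuclideanSpace ℝ (Fin n))}

theorem IsTestFunction.coord {φ : EuclideanSpace ℝ (Fin n) → EuclideanSpace ℝ (Fin n)}
    (hφ : IsTestFunction Ω φ) (i : Fin n) : IsTestFunction Ω (fun x => φ x i) := by
  have hs : tsupport (fun x => φ x i) ⊆ tsupport φ :=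
    closure_mono fun x hx h => hx (by simp [h])
  refine ⟨(contDiff_euclidean.1 hφ.1) i, ?_, hs.trans hφ.2.2⟩
  exact hφ.2.1.of_isClosed_subset (isClosed_tsupport _) hs

theorem IsTestFunction.partialDeriv {ψ : EuclideanSpace ℝ (Fin n) → ℝ}
    (hψ : IsTestFunction Ω ψ) (j : Fin n) : IsTestFunction Ω (VolIso.partialDeriv j ψ) := by
  have hs : tsupport (VolIso.partialDeriv j ψ) ⊆ tsupport ψ :=
    tsupport_fderiv_apply_subset ℝ (EuclideanSpace.single j (1 : ℝ))
  refine ⟨(hψ.1.fderiv_right (by simp)).clm_apply contDiff_const, ?_, hs.trans hψ.2.2⟩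
  exact hψ.2.1.of_isClosed_subset (isClosed_tsupport _) hs

theorem IsTestFunction.integrable {ψ : EuclideanSpace ℝ (Fin n) → ℝ}
    (hψ : IsTestFunction Ω ψ) : Integrable ψ :=
  hψ.1.continuous.integrable_of_hasCompactSupport hψ.2.1

theorem IsTestFunction.setIntegral_partialDeriv {ψ : EuclideanSpace ℝ (Fin n) → ℝ}
    (hψ : IsTestFunction Ω ψ) (j : Fin n) : ∫ x in Ω, VolIso.partialDeriv j ψ x = 0 := by
  rw [setIntegral_eq_integral_of_forall_compl_eq_zero fun x hx =>
    image_eq_zero_of_notMem_tsupport fun h => hx ((hψ.partialDeriv j).2.2 h)]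
  have := integral_mul_fderiv_eq_neg_fderiv_mul_of_integrable (μ := volume)
    (f := fun _ : EuclideanSpace ℝ (Fin n) => (1 : ℝ)) (g := ψ)
    (v := EuclideanSpace.single j 1) (by simp)
    (by simpa [VolIso.partialDeriv] using! (hψ.partialDeriv j).integrable)
    (by simpa using hψ.integrable) (fun x _ => differentiableAt_const _)
    (fun x _ => hψ.1.differentiable (by simp) x)
  simpa [VolIso.partialDeriv] using this

theorem partialDeriv_comm {ψ : EuclideanSpace ℝ (Fin n) → ℝ} (hψ : ContDiff ℝ ∞ ψ) (i j : Fin n)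
    (x : EuclideanSpace ℝ (Fin n)) :
    partialDeriv i (partialDeriv j ψ) x = partialDeriv j (partialDeriv i ψ) x := by
  have hd : Differentiable ℝ (fderiv ℝ ψ) :=
    (hψ.fderiv_right (m := 1) (by norm_cast)).differentiable (by simp)
  have e : ∀ i j : Fin n, partialDeriv i (partialDeriv j ψ) x =
      fderiv ℝ (fderiv ℝ ψ) x (EuclideanSpace.single i 1) (EuclideanSpace.single j 1) := by
    intro i j
    unfold partialDeriv
    rw [fderiv_clm_apply (hd x) (differentiableAt_const _)]
    simp
  rw [e, e]
  exact (hψ.contDiffAt.isSymmSndFDerivAt (by simp; norm_cast)) _ _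

variable {θ : EuclideanSpace ℝ (Fin n) → EuclideanSpace ℝ (Fin n)}
  {G : EuclideanSpace ℝ (Fin n) → Matrix (Fin n) (Fin n) ℝ}

theorem MemSobolevZeroInfty.integrable_mul (hθ : MemSobolevZeroInfty Ω θ G) (i j : Fin n)
    {g : EuclideanSpace ℝ (Fin n) → ℝ} (hg : Integrable g (volume.restrict Ω)) :
    Integrable (fun x => G x i j * g x) (volume.restrict Ω) :=
  hg.mul_of_top_right (hθ.1.memLp_grad i j)

theorem MemSobolevZeroInfty.integrable_grad (hθ : MemSobolevZeroInfty Ω θ G)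
    (hΩ : volume Ω ≠ ⊤) (i j : Fin n) : Integrable (fun x => G x i j) (volume.restrict Ω) := by
  have : IsFiniteMeasure (volume.restrict Ω) := isFiniteMeasure_restrict.2 hΩ
  exact memLp_one_iff_integrable.1 ((hθ.1.memLp_grad i j).mono_exponent le_top)

theorem MemSobolevZeroInfty.integral_grad (hθ : MemSobolevZeroInfty Ω θ G)
    (hΩ : volume Ω ≠ ⊤) (i j : Fin n) : ∫ x in Ω, G x i j = 0 := by
  obtain ⟨φ, hφ, -, hG⟩ := hθ.2
  have := tendsto_integral_of_L1' _ (hθ.integrable_grad hΩ i j).aestronglyMeasurable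
    (Eventually.of_forall fun k => (((hφ k).coord i).partialDeriv j).integrable.integrableOn)
    (hG i j)
  simp only [((hφ _).coord i).setIntegral_partialDeriv j] at this
  exact (tendsto_nhds_unique this tendsto_const_nhds)

/-- Only one factor is approximated: the other is bounded, so `L¹` convergence of the gradients of
the test functions is enough. -/
theorem MemSobolevZeroInfty.tendsto_integral_mul (hθ : MemSobolevZeroInfty Ω θ G)
    (hΩ : volume Ω ≠ ⊤) (i j i' j' : Fin n)
    {φ : ℕ → EuclideanSpace ℝ (Fin n) → EuclideanSpace ℝ (Fin n)}
    (hφ : ∀ k, IsTestFunction Ω (φ k))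
    (hG : Tendsto (fun k => eLpNorm (fun x => partialDeriv j' (fun y => φ k y i') x - G x i' j') 1
      (volume.restrict Ω)) atTop (𝓝 0)) :
    Tendsto (fun k => ∫ x in Ω, G x i j * partialDeriv j' (fun y => φ k y i') x) atTop
      (𝓝 (∫ x in Ω, G x i j * G x i' j')) := by
  have hint : ∀ k, Integrable (partialDeriv j' (fun y => φ k y i')) (volume.restrict Ω) :=
    fun k => (((hφ k).coord i').partialDeriv j').integrable.integrableOn
  have hg := hθ.integrable_grad hΩ i' j'
  refine tendsto_integral_of_L1' _ (hθ.integrable_mul i j hg).aestronglyMeasurable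
    (Eventually.of_forall fun k => hθ.integrable_mul i j (hint k)) ?_
  have hb : ∀ k, eLpNorm ((fun x => G x i j * partialDeriv j' (fun y => φ k y i') x) -
      fun x => G x i j * G x i' j') 1 (volume.restrict Ω) ≤
      eLpNorm (fun x => G x i j) ⊤ (volume.restrict Ω) *
      eLpNorm (fun x => partialDeriv j' (fun y => φ k y i') x - G x i' j') 1
        (volume.restrict Ω) := fun k => by
    refine le_trans (le_of_eq ?_) (eLpNorm_smul_le_eLpNorm_top_mul_eLpNorm 1
      ((hint k).sub hg).aestronglyMeasurable _)
    congr 1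
    ext x
    simp [mul_sub]
  refine tendsto_of_tendsto_of_tendsto_of_le_of_le tendsto_const_nhds ?_ (fun _ => zero_le) hb
  have := ENNReal.Tendsto.const_mul hG (Or.inr (hθ.1.memLp_grad i j).eLpNorm_ne_top)
  simpa using this

/-- With the second factor replaced by the gradient of a test function, both products equal `-∫ θᵢ
∂ⱼ∂ⱼ' φ`, by the definition of the weak gradient and the symmetry of second derivatives. -/
theorem MemSobolevZeroInfty.integral_minor (hθ : MemSobolevZeroInfty Ω θ G)
    (hΩ : volume Ω ≠ ⊤) (i i' j j' : Fin n) :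
    ∫ x in Ω, (G x i j * G x i' j' - G x i j' * G x i' j) = 0 := by
  obtain ⟨φ, hφ, -, hG⟩ := hθ.2
  have h1 := hθ.tendsto_integral_mul hΩ i j i' j' hφ (hG i' j')
  have h2 := hθ.tendsto_integral_mul hΩ i j' i' j hφ (hG i' j)
  have e : ∀ k, ∫ x in Ω, G x i j * partialDeriv j' (fun y => φ k y i') x =
      ∫ x in Ω, G x i j' * partialDeriv j (fun y => φ k y i') x := fun k => by
    have hψ := (hφ k).coord i'
    have w1 := hθ.1.weakGradient _ (hψ.partialDeriv j') i j
    have w2 := hθ.1.weakGradient _ (hψ.partialDeriv j) i j'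
    simp only [partialDeriv_comm hψ.1 j j'] at w1
    linarith
  simp only [e] at h1
  rw [integral_sub (hθ.integrable_mul i j (hθ.integrable_grad hΩ i' j'))
    (hθ.integrable_mul i j' (hθ.integrable_grad hΩ i' j)), tendsto_nhds_unique h1 h2, sub_self]

end NullLagrangian

/-! ### Affine functions of the minors in the plane -/

section Plane

variable {Ω : Set (EuclideanSpace ℝ (Fin 2))}
  {θ : EuclideanSpace ℝ (Fin 2) → EuclideanSpace ℝ (Fin 2)}
  {G : EuclideanSpace ℝ (Fin 2) → Matrix (Fin 2) (Fin 2) ℝ}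

theorem det_add_eq (A B : Matrix (Fin 2) (Fin 2) ℝ) :
    (A + B).det = A.det + A 0 0 * B 1 1 + A 1 1 * B 0 0 - A 0 1 * B 1 0 - A 1 0 * B 0 1 +
      (B 0 0 * B 1 1 - B 0 1 * B 1 0) := by
  simp only [Matrix.det_fin_two, Matrix.add_apply]
  ring

/-- An integrable function with vanishing integral. -/
def ZeroMean {α : Type*} [MeasurableSpace α] (μ : Measure α) (g : α → ℝ) : Prop :=
  Integrable g μ ∧ ∫ x, g x ∂μ = 0

section ZeroMean

variable {α : Type*} [MeasurableSpace α] {μ : Measure α} {g₁ g₂ : α → ℝ}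

theorem ZeroMean.add (h₁ : ZeroMean μ g₁) (h₂ : ZeroMean μ g₂) :
    ZeroMean μ (fun x => g₁ x + g₂ x) :=
  ⟨h₁.1.add h₂.1, by rw [integral_add h₁.1 h₂.1, h₁.2, h₂.2, add_zero]⟩

theorem ZeroMean.const_mul (c : ℝ) (h₁ : ZeroMean μ g₁) : ZeroMean μ (fun x => c * g₁ x) :=
  ⟨h₁.1.const_mul c, by rw [integral_const_mul, h₁.2, mul_zero]⟩

theorem ZeroMean.sum {ι : Type*} {s : Finset ι} {g : ι → α → ℝ} (h : ∀ i, ZeroMean μ (g i)) :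
    ZeroMean μ (fun x => ∑ i ∈ s, g i x) :=
  ⟨integrable_finsetSum _ fun i _ => (h i).1, by
    rw [integral_finsetSum _ fun i _ => (h i).1]
    exact Finset.sum_eq_zero fun i _ => (h i).2⟩

end ZeroMean

theorem MemSobolevZeroInfty.zeroMean_grad (hθ : MemSobolevZeroInfty Ω θ G)
    (hΩ : volume Ω ≠ ⊤) (i j : Fin 2) : ZeroMean (volume.restrict Ω) (fun x => G x i j) :=
  ⟨hθ.integrable_grad hΩ i j, hθ.integral_grad hΩ i j⟩

theorem MemSobolevZeroInfty.zeroMean_det (hθ : MemSobolevZeroInfty Ω θ G)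
    (hΩ : volume Ω ≠ ⊤) (F₀ : Matrix (Fin 2) (Fin 2) ℝ) :
    ZeroMean (volume.restrict Ω) (fun x => (F₀ + G x).det - F₀.det) := by
  have hg := hθ.integrable_grad hΩ
  have hm : ZeroMean (volume.restrict Ω) (fun x => G x 0 0 * G x 1 1 - G x 0 1 * G x 1 0) :=
    ⟨(hθ.integrable_mul 0 0 (hg 1 1)).sub (hθ.integrable_mul 0 1 (hg 1 0)),
      hθ.integral_minor hΩ 0 1 0 1⟩
  have hz := hθ.zeroMean_grad hΩ
  have key := ((((hz 1 1).const_mul (F₀ 0 0)).add ((hz 0 0).const_mul (F₀ 1 1))).add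
    (((hz 1 0).const_mul (-F₀ 0 1)).add ((hz 0 1).const_mul (-F₀ 1 0)))).add hm
  convert key using 2 with x
  rw [det_add_eq]
  ring

theorem MemSobolevZeroInfty.zeroMean_tangent (hθ : MemSobolevZeroInfty Ω θ G)
    (hΩ : volume Ω ≠ ⊤) (F₀ : Matrix (Fin 2) (Fin 2) ℝ) (A : Fin 2 → Fin 2 → ℝ) (m : ℝ) :
    ZeroMean (volume.restrict Ω) (fun x =>
      ∑ i, ∑ j, A i j * ((F₀ + G x) i j - F₀ i j) + m * ((F₀ + G x).det - F₀.det)) := by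
  have := (ZeroMean.sum (s := Finset.univ) fun i => ZeroMean.sum (s := Finset.univ) fun j =>
    (hθ.zeroMean_grad hΩ i j).const_mul (A i j)).add ((hθ.zeroMean_det hΩ F₀).const_mul m)
  simpa using this

end Plane

/-! ### Quasiconvexity in terms of real integrals -/

section Quasiconvexity

theorem lintegral_toENNReal_coe {α : Type*} [MeasurableSpace α] {μ : Measure α} {g : α → EReal}
    {v : α → ℝ} (h : g =ᵐ[μ] fun x => (v x : EReal)) :
    ∫⁻ x, (g x).toENNReal ∂μ = ∫⁻ x, ENNReal.ofReal (v x) ∂μ ∧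
      ∫⁻ x, (-g x).toENNReal ∂μ = ∫⁻ x, ENNReal.ofReal (-v x) ∂μ := by
  constructor <;> refine lintegral_congr_ae (h.mono fun x hx => ?_)
  · simp only [hx, EReal.real_coe_toENNReal]
  · simp only [hx, ← EReal.coe_neg, EReal.real_coe_toENNReal]

theorem integrable_max_zero_of_lintegral_ofReal {α : Type*} [MeasurableSpace α] {μ : Measure α}
    {v : α → ℝ} (hv : AEMeasurable v μ) (h : ∫⁻ x, ENNReal.ofReal (v x) ∂μ ≠ ⊤) :
    Integrable (fun x => max (v x) 0) μ := by
  refine (lintegral_ofReal_ne_top_iff_integrable (f := fun x => max (v x) 0) (hv.max aemeasurable_const).aestronglyMeasurable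
    (Eventually.of_forall fun x => le_max_right _ _)).1 ?_
  simpa using h

theorem integrable_of_lintegral_ofReal {α : Type*} [MeasurableSpace α] {μ : Measure α}
    {v : α → ℝ} (hv : AEMeasurable v μ) (h1 : ∫⁻ x, ENNReal.ofReal (v x) ∂μ ≠ ⊤)
    (h2 : ∫⁻ x, ENNReal.ofReal (-v x) ∂μ ≠ ⊤) : Integrable v μ := by
  have := (integrable_max_zero_of_lintegral_ofReal hv h1).sub
    (integrable_max_zero_of_lintegral_ofReal hv.neg h2)
  refine this.congr (Eventually.of_forall fun x => ?_)
  show max (v x) 0 - max (-v x) 0 = v x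
  rcases le_total 0 (v x) with h | h
  · rw [max_eq_left h, max_eq_right (by linarith), sub_zero]
  · rw [max_eq_right h, max_eq_left (by linarith)]; ring

theorem extIntegral_eq_coe {n : ℕ} {Ω : Set (EuclideanSpace ℝ (Fin n))}
    {g : EuclideanSpace ℝ (Fin n) → EReal} {v : EuclideanSpace ℝ (Fin n) → ℝ}
    (h : g =ᵐ[volume.restrict Ω] fun x => (v x : EReal))
    (hv : Integrable v (volume.restrict Ω)) :
    extIntegral Ω g = ((∫ x in Ω, v x : ℝ) : EReal) := by
  obtain ⟨e1, e2⟩ := lintegral_toENNReal_coe h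
  rw [extIntegral, e1, e2, integral_eq_lintegral_pos_part_sub_lintegral_neg_part hv, EReal.coe_sub]
  have n1 : ∫⁻ x in Ω, ENNReal.ofReal (v x) ≠ ⊤ := hv.lintegral_lt_top.ne
  have n2 : ∫⁻ x in Ω, ENNReal.ofReal (-v x) ≠ ⊤ := hv.neg.lintegral_lt_top.ne
  rw [EReal.coe_ennreal_toReal n1, EReal.coe_ennreal_toReal n2]

theorem extendGLPos_ae_eq {V : Matrix (Fin 2) (Fin 2) ℝ → ℝ} {F₀ : Matrix (Fin 2) (Fin 2) ℝ}
    {α : Type*} [MeasurableSpace α] {μ : Measure α} {G : α → Matrix (Fin 2) (Fin 2) ℝ}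
    (h : ∀ᵐ x ∂μ, 0 < (F₀ + G x).det) :
    (fun x => extendGLPos V (F₀ + G x)) =ᵐ[μ] fun x => (V (F₀ + G x) : EReal) :=
  h.mono fun _ hx => if_pos hx

/-- The quasiconvexity inequality for those deformations whose energy is a real function with an
integrable positive part. -/
def QuasiconvexOnFinite (V : Matrix (Fin 2) (Fin 2) ℝ → ℝ) : Prop :=
  ∀ Ω : Set (EuclideanSpace ℝ (Fin 2)), IsOpen Ω → IsConnected Ω → volume Ω ≠ ⊤ →
    ∀ (F₀ : Matrix (Fin 2) (Fin 2) ℝ)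
      (θ : EuclideanSpace ℝ (Fin 2) → EuclideanSpace ℝ (Fin 2))
      (G : EuclideanSpace ℝ (Fin 2) → Matrix (Fin 2) (Fin 2) ℝ),
      MemSobolevZeroInfty Ω θ G → 0 < F₀.det →
      (∀ᵐ x ∂volume.restrict Ω, 0 < (F₀ + G x).det) →
      AEMeasurable (fun x => V (F₀ + G x)) (volume.restrict Ω) →
      ∫⁻ x in Ω, ENNReal.ofReal (V (F₀ + G x)) ≠ ⊤ →
        Integrable (fun x => V (F₀ + G x)) (volume.restrict Ω) ∧
          (volume Ω).toReal * V F₀ ≤ ∫ x in Ω, V (F₀ + G x)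

theorem IsQuasiconvexGLPos.quasiconvexOnFinite {V : Matrix (Fin 2) (Fin 2) ℝ → ℝ}
    (hV : IsQuasiconvexGLPos V) : QuasiconvexOnFinite V := by
  intro Ω ho hc hΩ F₀ θ G hθ hF₀ hG hm hp
  have hae := extendGLPos_ae_eq (V := V) hG
  obtain ⟨e1, e2⟩ := lintegral_toENNReal_coe hae
  have hq := hV Ω ho hc hΩ F₀ θ G hθ
    ⟨hm.coe_real_ereal.congr hae.symm, Or.inl (by rwa [e1])⟩
  rw [extendGLPos, if_pos hF₀, ← EReal.coe_ennreal_toReal hΩ, ← EReal.coe_mul] at hq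
  have hi : Integrable (fun x => V (F₀ + G x)) (volume.restrict Ω) := by
    -- An infinite negative part would make the integral `⊥`, below the finite value `|Ω| V F₀`.
    refine integrable_of_lintegral_ofReal hm hp fun hn => ?_
    rw [extIntegral, e1, e2, hn, EReal.coe_ennreal_top, EReal.sub_top, le_bot_iff] at hq
    exact EReal.coe_ne_bot _ hq
  refine ⟨hi, ?_⟩
  rw [extIntegral_eq_coe hae hi] at hq
  exact_mod_cast hq

theorem QuasiconvexOnFinite.isQuasiconvexGLPos {V : Matrix (Fin 2) (Fin 2) ℝ → ℝ}
    (hV : QuasiconvexOnFinite V) : IsQuasiconvexGLPos V := by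
  intro Ω ho hc hΩ F₀ θ G hθ ⟨hm, hex⟩
  have hΩ0 : 0 < volume Ω := ho.measure_pos volume hc.nonempty
  by_cases hp : ∫⁻ x in Ω, (extendGLPos V (F₀ + G x)).toENNReal = ⊤
  · have hn := hex.resolve_left (not_not.2 hp)
    rw [extIntegral, hp, EReal.coe_ennreal_top, EReal.top_sub]
    · exact le_top
    · simpa using hn
  have hG : ∀ᵐ x ∂volume.restrict Ω, 0 < (F₀ + G x).det := by
    refine (ae_lt_top' hm.ereal_toENNReal hp).mono fun x hx => ?_
    by_contra h
    rw [extendGLPos, if_neg h] at hx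
    simp at hx
  -- The determinant of `F₀` is the mean of the almost everywhere positive `det (F₀ + G x)`, so it
  -- cannot be nonpositive.
  have hF₀ : 0 < F₀.det := by
    have h1 := (hθ.zeroMean_det hΩ F₀)
    by_contra h
    push Not at h
    have h2 : ∀ᵐ x ∂volume.restrict Ω, 0 < (F₀ + G x).det - F₀.det :=
      hG.mono fun x hx => by linarith
    have h3 := (integral_eq_zero_iff_of_nonneg_ae (h2.mono fun x hx => hx.le) h1.1).1 h1.2
    have h4 : ∀ᵐ x ∂volume.restrict Ω, False := by
      filter_upwards [h2, h3] with x hx hx'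
      exact hx.ne' hx'
    simp only [ae_iff, not_false_iff] at h4
    simp at h4
    exact hΩ0.ne' h4
  have hae := extendGLPos_ae_eq (V := V) hG
  obtain ⟨e1, e2⟩ := lintegral_toENNReal_coe hae
  have hm' : AEMeasurable (fun x => V (F₀ + G x)) (volume.restrict Ω) :=
    hm.ereal_toReal.congr (hae.mono fun x hx => by simp only [hx, EReal.toReal_coe])
  obtain ⟨hi, hle⟩ := hV Ω ho hc hΩ F₀ θ G hθ hF₀ hG hm' (by rwa [← e1])
  rw [extIntegral_eq_coe hae hi, extendGLPos, if_pos hF₀, ← EReal.coe_ennreal_toReal hΩ,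
    ← EReal.coe_mul]
  exact_mod_cast hle

/-- Extending `V` by zero off the open set of positive determinant gives a Borel function. -/
theorem aemeasurable_comp_of_continuousOn {V : Matrix (Fin 2) (Fin 2) ℝ → ℝ}
    (hV : ContinuousOn V {F | 0 < F.det}) {α : Type*} [MeasurableSpace α] {μ : Measure α}
    {G : α → Matrix (Fin 2) (Fin 2) ℝ} (hG : ∀ i j, AEMeasurable (fun x => G x i j) μ)
    (h : ∀ᵐ x ∂μ, 0 < (G x).det) : AEMeasurable (fun x => V (G x)) μ := by
  have hG' : AEMeasurable (β := Fin 2 → Fin 2 → ℝ) (fun x i j => G x i j) μ :=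
    aemeasurable_pi_lambda _ fun i => aemeasurable_pi_lambda _ fun j => hG i j
  set S : Set (Fin 2 → Fin 2 → ℝ) := {F | 0 < Matrix.det F}
  have hO : IsOpen S := isOpen_lt continuous_const (Continuous.matrix_det continuous_id)
  have hS : MeasurableSet S := hO.measurableSet
  classical
  have hp : Measurable (S.piecewise V fun _ => 0) :=
    ContinuousOn.measurable_piecewise (α := Fin 2 → Fin 2 → ℝ) hV continuousOn_const hS
  refine (hp.comp_aemeasurable hG').congr (h.mono fun x hx => ?_)
  exact Set.piecewise_eq_of_mem S _ _ hx

theorem isQuasiconvexGLPos_zero : IsQuasiconvexGLPos fun _ : Matrix (Fin 2) (Fin 2) ℝ => 0 :=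
  QuasiconvexOnFinite.isQuasiconvexGLPos fun _ _ _ _ _ _ _ _ _ _ _ _ => by simp

/-- An energy is quasiconvex if at each matrix it is supported by a positive multiple of a
quasiconvex energy up to null Lagrangians. -/
theorem IsQuasiconvexGLPos.of_support {V V₀ : Matrix (Fin 2) (Fin 2) ℝ → ℝ}
    (hV₀ : IsQuasiconvexGLPos V₀) (hcont : ContinuousOn V₀ {F | 0 < F.det}) {a : ℝ} (ha : 0 < a)
    (hs : ∀ F₀ : Matrix (Fin 2) (Fin 2) ℝ, 0 < F₀.det →
      ∃ (A : Fin 2 → Fin 2 → ℝ) (m : ℝ), ∀ F : Matrix (Fin 2) (Fin 2) ℝ, 0 < F.det →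
        V F₀ + a * (V₀ F - V₀ F₀) +
          (∑ i, ∑ j, A i j * (F i j - F₀ i j) + m * (F.det - F₀.det)) ≤ V F) :
    IsQuasiconvexGLPos V := by
  refine QuasiconvexOnFinite.isQuasiconvexGLPos fun Ω ho hc hΩ F₀ θ G hθ hF₀ hG hm hp => ?_
  have : IsFiniteMeasure (volume.restrict Ω) := isFiniteMeasure_restrict.2 hΩ
  obtain ⟨A, m, hAm⟩ := hs F₀ hF₀
  obtain ⟨hτi, hτ0⟩ := hθ.zeroMean_tangent hΩ F₀ A m
  set τ : EuclideanSpace ℝ (Fin 2) → ℝ := fun x =>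
    ∑ i, ∑ j, A i j * ((F₀ + G x) i j - F₀ i j) + m * ((F₀ + G x).det - F₀.det)
  have hle : ∀ᵐ x ∂volume.restrict Ω,
      V F₀ + a * (V₀ (F₀ + G x) - V₀ F₀) + τ x ≤ V (F₀ + G x) := hG.mono fun x hx => hAm _ hx
  have hpos : Integrable (fun x => max (V (F₀ + G x)) 0) (volume.restrict Ω) :=
    integrable_max_zero_of_lintegral_ofReal hm hp
  have hm₀ : AEMeasurable (fun x => V₀ (F₀ + G x)) (volume.restrict Ω) := by
    refine aemeasurable_comp_of_continuousOn hcont (fun i j => ?_) hG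
    exact (hθ.1.memLp_grad i j).aestronglyMeasurable.aemeasurable.const_add (F₀ i j)
  have hu : Integrable (fun x => (max (V (F₀ + G x)) 0 - τ x) / a + (V₀ F₀ - V F₀ / a))
      (volume.restrict Ω) := ((hpos.sub hτi).div_const a).add (integrable_const _)
  -- Solving the support inequality for `V₀` bounds it above by an integrable function, so its
  -- quasiconvexity applies to this deformation.
  have hp₀ : ∫⁻ x in Ω, ENNReal.ofReal (V₀ (F₀ + G x)) ≠ ⊤ := by
    refine ne_top_of_le_ne_top hu.lintegral_lt_top.ne (lintegral_mono_ae ?_)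
    refine hle.mono fun x hx => ENNReal.ofReal_le_ofReal ?_
    have h1 : a * V₀ (F₀ + G x) ≤ max (V (F₀ + G x)) 0 - τ x + (a * V₀ F₀ - V F₀) := by
      linarith [le_max_left (V (F₀ + G x)) 0]
    have h2 : (max (V (F₀ + G x)) 0 - τ x) / a + (V₀ F₀ - V F₀ / a) =
        (max (V (F₀ + G x)) 0 - τ x + (a * V₀ F₀ - V F₀)) / a := by field_simp
    rw [h2, le_div_iff₀ ha]
    linarith
  obtain ⟨hi₀, hq₀⟩ := hV₀.quasiconvexOnFinite Ω ho hc hΩ F₀ θ G hθ hF₀ hG hm₀ hp₀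
  have hl0 : Integrable (fun x => a * (V₀ (F₀ + G x) - V₀ F₀)) (volume.restrict Ω) :=
    (hi₀.sub (integrable_const _)).const_mul a
  have hl1 : Integrable (fun x => V F₀ + a * (V₀ (F₀ + G x) - V₀ F₀)) (volume.restrict Ω) :=
    (integrable_const _).add hl0
  have hl : Integrable (fun x => V F₀ + a * (V₀ (F₀ + G x) - V₀ F₀) + τ x)
      (volume.restrict Ω) := hl1.add hτi
  have hi : Integrable (fun x => V (F₀ + G x)) (volume.restrict Ω) :=
    integrable_of_le_of_le hm.aestronglyMeasurable hle
      (Eventually.of_forall fun x => le_max_left _ _) hl hpos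
  refine ⟨hi, ?_⟩
  have hmono := integral_mono_ae hl hi hle
  rw [integral_add hl1 hτi, hτ0, integral_add (integrable_const _) hl0, integral_const_mul,
    integral_sub hi₀ (integrable_const _)] at hmono
  simp only [integral_const, Measure.real, Measure.restrict_apply_univ, smul_eq_mul] at hmono
  nlinarith [mul_le_mul_of_nonneg_left hq₀ ha.le]

end Quasiconvexity

/-! ### Reduction of the volumetric part -/

section Final

variable {W : Matrix (Fin 2) (Fin 2) ℝ → ℝ} {h f : ℝ → ℝ}

theorem isRankOneConvexGLPos_const_mul {V V₀ : Matrix (Fin 2) (Fin 2) ℝ → ℝ}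
    (hV₀ : IsRankOneConvexGLPos V₀) {a : ℝ} (ha : 0 < a)
    (h : ∀ F : Matrix (Fin 2) (Fin 2) ℝ, 0 < F.det → V₀ F = a * V F) :
    IsRankOneConvexGLPos V := by
  rw [isRankOneConvexGLPos_iff] at hV₀ ⊢
  intro F H hH
  refine ((hV₀ F H hH).smul (inv_nonneg.2 ha.le)).congr fun t ht => ?_
  simp only [smul_eq_mul]
  rw [h _ ht]
  field_simp

/-- A rank-one convex energy without volumetric part is quasiconvex. -/
theorem isQuasiconvexGLPos_isochoric (h_symm : ∀ t : ℝ, 0 < t → h t = h t⁻¹)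
    (h_roc : IsRankOneConvexGLPos (splitEnergy h (fun _ => 0)))
    (hd : ∀ t : ℝ, 0 < t → DifferentiableAt ℝ h t) :
    IsQuasiconvexGLPos (splitEnergy h (fun _ => 0)) := by
  -- Support over the zero energy is polyconvexity. Since `m ≥ 0`, the tangent of `h` can be
  -- composed with that of the distortion.
  refine isQuasiconvexGLPos_zero.of_support continuousOn_const one_pos fun F₀ hF₀ => ?_
  obtain ⟨m, hm, hle⟩ := exists_tangent_isochoric h_symm h_roc hd (one_le_distortion hF₀)
  obtain ⟨A, b, hA⟩ := exists_tangent_distortion hF₀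
  refine ⟨fun i j => m * A i j, m * b, fun F hF => ?_⟩
  have h1 := hle _ (div_pos (sv₁_pos hF) (sv₂_pos hF))
  have h2 := mul_le_mul_of_nonneg_left (hA F hF) hm
  rw [splitEnergy_of_det_pos _ _ hF, splitEnergy_of_det_pos _ _ hF₀]
  simp only [mul_assoc, ← Finset.mul_sum]
  linarith

/-- The isochoric part is continuous as `W - f ∘ det`; `of_support` needs this for measurability. -/
theorem continuousOn_splitEnergy_log
    (h_split : ∀ F : Matrix (Fin 2) (Fin 2) ℝ, 0 < F.det → W F = splitEnergy h f F)
    (h_diff : TwiceDifferentiableOn W {F | 0 < F.det})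
    (hf : TwiceDifferentiableOn f (Set.Ioi 0)) (c : ℝ) :
    ContinuousOn (splitEnergy h (fun z => c * Real.log z)) {F | 0 < F.det} := by
  have hW : ContinuousOn W {F | 0 < F.det} := fun F hF =>
    (h_diff F hF).1.continuousAt.continuousWithinAt
  have hdet : Continuous (fun F : Matrix (Fin 2) (Fin 2) ℝ => F.det) :=
    Continuous.matrix_det continuous_id
  have hf' : ContinuousOn (fun F : Matrix (Fin 2) (Fin 2) ℝ => f F.det) {F | 0 < F.det} :=
    fun F hF => (ContinuousAt.comp (f := fun F : Matrix (Fin 2) (Fin 2) ℝ => F.det)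
      (hf F.det hF).1.continuousAt hdet.continuousAt).continuousWithinAt
  have hl : ContinuousOn (fun F : Matrix (Fin 2) (Fin 2) ℝ => c * Real.log F.det)
      {F | 0 < F.det} :=
    continuousOn_const.mul (hdet.continuousOn.log fun F hF => (ne_of_gt hF))
  refine ((hW.sub hf').add hl).congr fun F hF => ?_
  rw [splitEnergy_of_det_pos _ _ hF]
  show _ = W F - f F.det + c * Real.log F.det
  rw [h_split F hF, splitEnergy_of_det_pos _ _ hF]
  ring

/-- The volumetric part of the energy is `c log` up to a convex function of the determinant. -/
theorem volumetric_sub_log_convex (hf : TwiceDifferentiableOn f (Set.Ioi 0)) {c : ℝ}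
    (hc : IsGLB ((fun z : ℝ => z ^ 2 * deriv (deriv f) z) '' Set.Ioi 0) (-c)) :
    ConvexOn ℝ (Set.Ioi 0) (fun z => f z - c * Real.log z) ∧
      ∀ z : ℝ, 0 < z → HasDerivAt (fun z => f z - c * Real.log z) (deriv f z - c * z⁻¹) z := by
  have d1 : ∀ z ∈ Set.Ioi (0 : ℝ), HasDerivAt (fun z => f z - c * Real.log z)
      (deriv f z - c * z⁻¹) z := fun z hz =>
    (hf.hasDerivAt hz).1.sub ((Real.hasDerivAt_log (ne_of_gt hz)).const_mul c)
  have d2 : ∀ z ∈ Set.Ioi (0 : ℝ), HasDerivAt (fun z => deriv f z - c * z⁻¹)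
      (deriv (deriv f) z - c * -(z ^ 2)⁻¹) z := fun z hz =>
    (hf.hasDerivAt hz).2.sub ((hasDerivAt_inv (ne_of_gt hz)).const_mul c)
  refine ⟨convexOn_of_hasDerivWithinAt2_nonneg (convex_Ioi 0)
    (fun z hz => (d1 z hz).continuousAt.continuousWithinAt)
    (fun z hz => (d1 z (interior_subset hz)).hasDerivWithinAt)
    (fun z hz => (d2 z (interior_subset hz)).hasDerivWithinAt) fun z hz => ?_, d1⟩
  have hz0 : 0 < z := interior_subset hz
  have h1 : -c ≤ z ^ 2 * deriv (deriv f) z := hc.1 ⟨z, hz0, rfl⟩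
  have h2 : deriv (deriv f) z - c * -(z ^ 2)⁻¹ =
      (z ^ 2 * deriv (deriv f) z + c) * (z ^ 2)⁻¹ := by field_simp; ring
  rw [h2]
  exact mul_nonneg (by linarith) (by positivity)

theorem isQuasiconvexGLPos_of_log
    (h_split : ∀ F : Matrix (Fin 2) (Fin 2) ℝ, 0 < F.det → W F = splitEnergy h f F)
    (h_diff : TwiceDifferentiableOn W {F | 0 < F.det})
    (hf : TwiceDifferentiableOn f (Set.Ioi 0)) {c : ℝ}
    (hc : IsGLB ((fun z : ℝ => z ^ 2 * deriv (deriv f) z) '' Set.Ioi 0) (-c))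
    (hq : IsQuasiconvexGLPos (splitEnergy h (fun z => c * Real.log z))) :
    IsQuasiconvexGLPos W := by
  obtain ⟨hconv, hder⟩ := volumetric_sub_log_convex hf hc
  refine hq.of_support (continuousOn_splitEnergy_log h_split h_diff hf c) one_pos fun F₀ hF₀ => ?_
  -- No linear term is needed: the slope is that of `f - c * log` at `det F₀`.
  refine ⟨0, deriv f F₀.det - c * F₀.det⁻¹, fun F hF => ?_⟩
  have := tangent_le_of_convexOn hconv hF₀ hF (hder _ hF₀)
  rw [h_split F hF, h_split F₀ hF₀]
  simp only [splitEnergy_of_det_pos _ _ hF, splitEnergy_of_det_pos _ _ hF₀, Pi.zero_apply,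
    zero_mul, Finset.sum_const_zero]
  linarith

/-- Positive multiples of an energy on `GL⁺(2)` inherit failure of quasiconvexity. -/
theorem not_isQuasiconvexGLPos_of_const_mul {V V₀ : Matrix (Fin 2) (Fin 2) ℝ → ℝ}
    (hV₀ : ¬ IsQuasiconvexGLPos V₀) (hcont : ContinuousOn V₀ {F | 0 < F.det}) {a : ℝ} (ha : 0 < a)
    (h : ∀ F : Matrix (Fin 2) (Fin 2) ℝ, 0 < F.det → V₀ F = a * V F) :
    ¬ IsQuasiconvexGLPos V := by
  intro hV
  have hcont' : ContinuousOn V {F | 0 < F.det} := by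
    refine (hcont.const_smul a⁻¹).congr fun F hF => ?_
    rw [Pi.smul_apply, h F hF, smul_eq_mul]
    field_simp
  -- The energy is supported by a multiple of `V`, with equality and no null Lagrangian.
  refine hV₀ (hV.of_support hcont' ha fun F₀ hF₀ => ⟨0, 0, fun F hF => ?_⟩)
  rw [h F hF, h F₀ hF₀]
  simp only [Pi.zero_apply, zero_mul, Finset.sum_const_zero]
  linarith

end Final

end VolIso

end

theorem lemma3p2 (W : Matrix (Fin 2) (Fin 2) ℝ → ℝ) (h f : ℝ → ℝ)
    (h_symm : ∀ t : ℝ, 0 < t → h t = h t⁻¹)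
    (h_split : ∀ F : Matrix (Fin 2) (Fin 2) ℝ, 0 < F.det → W F = VolIso.splitEnergy h f F)
    (h_diff : VolIso.TwiceDifferentiableOn W {F : Matrix (Fin 2) (Fin 2) ℝ | 0 < F.det})
    (h_roc : VolIso.IsRankOneConvexGLPos W) (h_not_qc : ¬ VolIso.IsQuasiconvexGLPos W) :
    VolIso.TwiceDifferentiableOn f (Set.Ioi 0) ∧
    ∃ c : ℝ, IsGLB ((fun z : ℝ => z ^ 2 * deriv (deriv f) z) '' Set.Ioi 0) (-c) ∧
      (VolIso.IsRankOneConvexGLPos (VolIso.splitEnergy h (fun z => c * Real.log z)) ∧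
        ¬ VolIso.IsQuasiconvexGLPos (VolIso.splitEnergy h (fun z => c * Real.log z))) ∧
      ((0 < c ∧
          VolIso.IsRankOneConvexGLPos (VolIso.splitEnergy (fun t => h t / |c|) Real.log) ∧
          ¬ VolIso.IsQuasiconvexGLPos (VolIso.splitEnergy (fun t => h t / |c|) Real.log)) ∨
        (c < 0 ∧
          VolIso.IsRankOneConvexGLPos
            (VolIso.splitEnergy (fun t => h t / |c|) (fun z => -Real.log z)) ∧
          ¬ VolIso.IsQuasiconvexGLPos
            (VolIso.splitEnergy (fun t => h t / |c|) (fun z => -Real.log z)))) := by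
  have hf := VolIso.twiceDifferentiableOn_volumetric h_symm h_split h_diff
  obtain ⟨b, hb⟩ : ∃ b, IsGLB ((fun z : ℝ => z ^ 2 * deriv (deriv f) z) '' Set.Ioi 0) b :=
    ⟨_, isGLB_csInf (Set.nonempty_Ioi.image _)
      (VolIso.bddBelow_volumetric h_split h_diff h_roc hf)⟩
  obtain ⟨c, rfl⟩ : ∃ c, b = -c := ⟨-b, (neg_neg b).symm⟩
  have hroc := VolIso.isRankOneConvexGLPos_log h_split h_diff h_roc hf hb
  have hnqc : ¬ VolIso.IsQuasiconvexGLPos (VolIso.splitEnergy h (fun z => c * Real.log z)) :=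
    fun hq => h_not_qc (VolIso.isQuasiconvexGLPos_of_log h_split h_diff hf hb hq)
  have hcont := VolIso.continuousOn_splitEnergy_log h_split h_diff hf c
  -- For `c = 0` the reduced energy is purely isochoric, where rank-one convexity already implies
  -- quasiconvexity.
  have hc0 : c ≠ 0 := by
    rintro rfl
    simp only [zero_mul] at hroc hnqc
    exact hnqc (VolIso.isQuasiconvexGLPos_isochoric h_symm hroc fun t ht =>
      VolIso.differentiableAt_isochoric h_symm h_split h_diff hf ht)
  have ha : 0 < |c| := abs_pos.2 hc0
  refine ⟨hf, c, hb, ⟨hroc, hnqc⟩, ?_⟩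
  rcases lt_or_gt_of_ne hc0 with hc | hc
  · have e : ∀ F : Matrix (Fin 2) (Fin 2) ℝ, 0 < F.det →
        VolIso.splitEnergy h (fun z => c * Real.log z) F =
          |c| * VolIso.splitEnergy (fun t => h t / |c|) (fun z => -Real.log z) F := fun F hF => by
      simp only [VolIso.splitEnergy_of_det_pos _ _ hF, mul_add, mul_div_cancel₀ _ ha.ne']
      rw [abs_of_neg hc]
      ring
    exact Or.inr ⟨hc, VolIso.isRankOneConvexGLPos_const_mul hroc ha e,
      VolIso.not_isQuasiconvexGLPos_of_const_mul hnqc hcont ha e⟩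
  · have e : ∀ F : Matrix (Fin 2) (Fin 2) ℝ, 0 < F.det →
        VolIso.splitEnergy h (fun z => c * Real.log z) F =
          |c| * VolIso.splitEnergy (fun t => h t / |c|) Real.log F := fun F hF => by
      simp only [VolIso.splitEnergy_of_det_pos _ _ hF, mul_add, mul_div_cancel₀ _ ha.ne']
      rw [abs_of_pos hc]
    exact Or.inl ⟨hc, VolIso.isRankOneConvexGLPos_const_mul hroc ha e,
      VolIso.not_isQuasiconvexGLPos_of_const_mul hnqc hcont ha e⟩
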